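/- All graphs are finite and simple. A $\llcorner$-path is a nontrivial path of the grid $\mathbb{Z}\times\mathbb{Z}$ that consists of a horizontal segment and a vertical segment, where the left end of the former is the lower end of the latter (the bend point); one of the two segments may be trivial, so that a straight segment is a degenerate $\llcorner$-path. An $[\llcorner]$-representation of a graph $G$ assigns to each vertex a $\llcorner$-path such that two distinct vertices are adjacent if and only if their paths share an edge of the grid. A split partition $(C,S)$ of $G$ is a partition of its vertex set into a clique $C$ and a stable set $S$. The bull has vertices $a,b,c,d,e$ and edges $ab,bc,cd,eb,ec$; an $S$-bull in $G$ is an induced bull whose three vertices of degree less than three in the bull (namely $a,d,e$) lie in $S$. The graph $U_1$ consists of a clique $\{u,c_1,c_2,c_3\}$ and a stable set $\{s_1,s_2,s_3\}$ with $N(s_i)=\{u,c_i\}$. The graph $S_4$ consists of a clique $\{c_1,\dots,c_6\}$ and a stable set $\{s_1,\dots,s_4\}$ with $N(s_1)=\{c_1,c_2\}$, $N(s_2)=\{c_2,c_3\}$, $N(s_3)=\{c_4,c_5\}$, $N(s_4)=\{c_5,c_6\}$. **Theorem.** (1) Let $G$ be a graph with a split partition $(C,S)$ and with no $S$-bull.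 Then $G$ has an $[\llcorner]$-representation if and only if $G$ contains neither $U_1$ nor $S_4$ as an induced subgraph. The same equivalence holds if degenerate $\llcorner$-paths are not admitted in the representation. (2) There is a polynomial-time certifying recognition algorithm: a random access machine program (unit-cost addition, truncated subtraction and comparison, no multiplication) and a polynomial $q$ such that, for every graph $G$ on $n$ vertices and every partition $(C,S)$ of its vertex set, the program halts after at most $q(n)$ steps and outputs one of the following: an $[\llcorner]$-representation of $G$ without degenerate paths (and then $(C,S)$ is a split partition and $G$ has no $S$-bull); or two vertices which show that $(C,S)$ is not a split partition; or an $S$-bull; or an induced $U_1$; or an induced $S_4$ of $G$. In particular, if $(C,S)$ is a split partition and $G$ has no $S$-bull, then it outputs either an $[\llcorner]$-representation of $G$ or an induced $U_1$ or $S_4$. -/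

import Mathlib

namespace EPG

/-! ### Paths of shape `⌞` on the grid and their edge intersection graphs -/

/-- A nontrivial `⌞`-shaped path on the grid `ℤ × ℤ`: from the bend point it runs `up` grid edges
upwards and `right` grid edges to the right. If one of the two arms has length `0`, the path is a
straight segment (a degenerate `⌞`). -/
@[ext]
structure LPath where
  bend : ℤ × ℤ
  up : ℕ
  right : ℕ
  nontrivial : 0 < up ∨ 0 < right

/-- The path really bends: both of its arms are nonempty. -/
def LPath.HasBend (P : LPath) : Prop := 0 < P.up ∧ 0 < P.right

/-- The set of grid edges of the path. -/
def LPath.edges (P : LPath) : Set (Sym2 (ℤ × ℤ)) :=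
  {e | ∃ i : ℕ, i < P.up ∧ e = s((P.bend.1, P.bend.2 + i), (P.bend.1, P.bend.2 + i + 1))} ∪
  {e | ∃ j : ℕ, j < P.right ∧ e = s((P.bend.1 + j, P.bend.2), (P.bend.1 + j + 1, P.bend.2))}

/-- The family `P` of `⌞`-paths represents `G`: two distinct vertices are adjacent if and only if
their paths share a grid edge. -/
def IsLRepresentation {V : Type*} (G : SimpleGraph V) (P : V → LPath) : Prop :=
  ∀ u v, u ≠ v → (G.Adj u v ↔ ((P u).edges ∩ (P v).edges).Nonempty)

/-! ### Split graphs, the bull, and the two obstructions -/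

/-- `(C, S)` partitions the vertices into a clique `C` and a stable set `S`. -/
def IsSplitPartition {V : Type*} (G : SimpleGraph V) (C S : Set V) : Prop :=
  IsCompl C S ∧ G.IsClique C ∧ G.IsIndepSet S

/-- The bull: vertices `a, b, c, d, e = 0, 1, 2, 3, 4` and edges `ab, bc, cd, eb, ec`. -/
def bull : SimpleGraph (Fin 5) :=
  SimpleGraph.fromEdgeSet {s(0, 1), s(1, 2), s(2, 3), s(4, 1), s(4, 2)}

/-- The induced copy `f` of the bull in `G` is an `S`-bull: all vertices that have degree less than
three in the bull lie in `S`. -/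
def IsSBull {V : Type*} {G : SimpleGraph V} (S : Set V) (f : bull ↪g G) : Prop :=
  ∀ v, (bull.neighborSet v).ncard < 3 → f v ∈ S

/-- `G` contains an `S`-bull. -/
def HasSBull {V : Type*} (G : SimpleGraph V) (S : Set V) : Prop :=
  ∃ f : bull ↪g G, IsSBull S f

/-- The split graph with clique `Fin c` and stable set `Fin s` in which the stable vertex `j` has
neighbourhood `N j`. -/
def splitGraph (c s : ℕ) (N : Fin s → Finset (Fin c)) : SimpleGraph (Fin c ⊕ Fin s) where
  Adj
    | .inl i, .inl j => i ≠ j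
    | .inl i, .inr j => i ∈ N j
    | .inr j, .inl i => i ∈ N j
    | .inr _, .inr _ => False
  symm := ⟨by rintro (i | i) (j | j) h <;> first | exact Ne.symm h | exact h⟩
  loopless := ⟨by rintro (i | i) h <;> first | exact h rfl | exact h⟩

/-- `U₁`: the net (a triangle `1, 2, 3` with one pendant vertex at each corner) together with a
vertex `u = 0` adjacent to all of its vertices. -/
def U1 : SimpleGraph (Fin 4 ⊕ Fin 3) :=
  splitGraph 4 3 ![{0, 1}, {0, 2}, {0, 3}]

/-- `S₄`: two vertex-disjoint gems whose clique vertices together form a clique on six vertices. -/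
def S4 : SimpleGraph (Fin 6 ⊕ Fin 4) :=
  splitGraph 6 4 ![{0, 1}, {1, 2}, {3, 4}, {4, 5}]

/-! ### Programs with a step count

A random access machine in the form of a structured programming language: numerical variables and
arrays, indexed by natural numbers, hold natural numbers; every program mentions only finitely many
of them by name, while the cells of an array are addressed by computed values. The arithmetic is
addition, truncated subtraction and comparison at unit cost; there is no multiplication, so that
polynomial time here is the same as polynomial time on a Turing machine. -/

/-- The memory: the variables and the arrays. -/
structure Store where
  var : ℕ → ℕ
  arr : ℕ → ℕ → ℕ

/-- Expressions: `get a e` is the cell `e` of the array `a`. -/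
inductive Expr where
  | lit (k : ℕ)
  | var (x : ℕ)
  | get (a : ℕ) (e : Expr)
  | add (e₁ e₂ : Expr)
  | sub (e₁ e₂ : Expr)
  | eq (e₁ e₂ : Expr)
  | lt (e₁ e₂ : Expr)

/-- The value of an expression. -/
def Expr.eval (σ : Store) : Expr → ℕ
  | lit k => k
  | var x => σ.var x
  | get a e => σ.arr a (e.eval σ)
  | add e₁ e₂ => e₁.eval σ + e₂.eval σ
  | sub e₁ e₂ => e₁.eval σ - e₂.eval σ
  | eq e₁ e₂ => if e₁.eval σ = e₂.eval σ then 1 else 0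
  | lt e₁ e₂ => if e₁.eval σ < e₂.eval σ then 1 else 0

/-- The number of steps it takes to evaluate an expression: one for each of its nodes. -/
def Expr.cost : Expr → ℕ
  | lit _ => 1
  | var _ => 1
  | get _ e => e.cost + 1
  | add e₁ e₂ => e₁.cost + e₂.cost + 1
  | sub e₁ e₂ => e₁.cost + e₂.cost + 1
  | eq e₁ e₂ => e₁.cost + e₂.cost + 1
  | lt e₁ e₂ => e₁.cost + e₂.cost + 1

/-- Programs. A condition counts as true if its value is not `0`. -/
inductive Prog where
  | skip
  /-- `x := e` -/
  | assign (x : ℕ) (e : Expr)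
  /-- `a[i] := e` -/
  | put (a : ℕ) (i e : Expr)
  | seq (p q : Prog)
  | ite (b : Expr) (p q : Prog)
  /-- while `b` do `p` -/
  | loop (b : Expr) (p : Prog)

/-- `Run p σ t τ`: started in the memory `σ`, the program `p` halts after `t` steps in the
memory `τ`. -/
inductive Run : Prog → Store → ℕ → Store → Prop
  | skip (σ : Store) : Run .skip σ 1 σ
  | assign (x : ℕ) (e : Expr) (σ : Store) :
      Run (.assign x e) σ (e.cost + 1) ⟨Function.update σ.var x (e.eval σ), σ.arr⟩
  | put (a : ℕ) (i e : Expr) (σ : Store) :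
      Run (.put a i e) σ (i.cost + e.cost + 1)
        ⟨σ.var, Function.update σ.arr a (Function.update (σ.arr a) (i.eval σ) (e.eval σ))⟩
  | seq {p q : Prog} {σ τ ρ : Store} {t₁ t₂ : ℕ} :
      Run p σ t₁ τ → Run q τ t₂ ρ → Run (.seq p q) σ (t₁ + t₂) ρ
  | iteTrue {b : Expr} {p q : Prog} {σ τ : Store} {t : ℕ} :
      b.eval σ ≠ 0 → Run p σ t τ → Run (.ite b p q) σ (b.cost + 1 + t) τ
  | iteFalse {b : Expr} {p q : Prog} {σ τ : Store} {t : ℕ} :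
      b.eval σ = 0 → Run q σ t τ → Run (.ite b p q) σ (b.cost + 1 + t) τ
  | loopFalse {b : Expr} {p : Prog} {σ : Store} :
      b.eval σ = 0 → Run (.loop b p) σ (b.cost + 1) σ
  | loopTrue {b : Expr} {p : Prog} {σ τ ρ : Store} {t₁ t₂ : ℕ} :
      b.eval σ ≠ 0 → Run p σ t₁ τ → Run (.loop b p) τ t₂ ρ →
        Run (.loop b p) σ (b.cost + 1 + t₁ + t₂) ρ

/-! ### The input and the output of the recognition algorithm -/

open Classical in
/-- The memory that holds the input: the number `n` of vertices in variable `0`, the adjacency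
matrix of `G` row by row in array `0`, the indicator of `C` in array `1`, and zeros elsewhere. -/
noncomputable def inputStore {n : ℕ} (G : SimpleGraph (Fin n)) (C : Set (Fin n)) : Store where
  var x := if x = 0 then n else 0
  arr a k :=
    if a = 0 then (if ∃ i j : Fin n, k = i * n + j ∧ G.Adj i j then 1 else 0)
    else if a = 1 then (if ∃ i : Fin n, k = i ∧ i ∈ C then 1 else 0)
    else 0

/-- The possible correct outputs for a graph `G` and a bipartition `(C, S)` of its vertices, where
`S` is the complement of `C`. Variable `1` holds the verdict, the arrays from `2` on hold the
certificate. -/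
inductive CorrectOutput {n : ℕ} (G : SimpleGraph (Fin n)) (C : Set (Fin n)) (σ : Store) : Prop
  /-- Verdict `0`: `(C, S)` is a split partition without `S`-bull and `G` has the
  `⌞`-representation whose bend points and arm lengths are given in the arrays `2`, `3`, `4`,
  `5`. -/
  | representation (P : Fin n → LPath)
      (verdict : σ.var 1 = 0)
      (split : IsSplitPartition G C Cᶜ)
      (noBull : ¬ HasSBull G Cᶜ)
      (output : ∀ v, (P v).bend = ((σ.arr 2 v : ℤ), (σ.arr 3 v : ℤ)) ∧
        (P v).up = σ.arr 4 v ∧ (P v).right = σ.arr 5 v)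
      (hasBend : ∀ v, (P v).HasBend)
      (rep : IsLRepresentation G P)
  /-- Verdict `1`: the two vertices given in array `2` show that `(C, S)` is not a split
  partition. -/
  | notSplit (u v : Fin n)
      (verdict : σ.var 1 = 1)
      (output : σ.arr 2 0 = u ∧ σ.arr 2 1 = v)
      (bad : u ≠ v ∧ ((u ∈ C ∧ v ∈ C ∧ ¬ G.Adj u v) ∨ (u ∉ C ∧ v ∉ C ∧ G.Adj u v)))
  /-- Verdict `2`: array `2` gives an `S`-bull. -/
  | sBull (f : bull ↪g G)
      (verdict : σ.var 1 = 2)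
      (output : ∀ i : Fin 5, σ.arr 2 i = f i)
      (inS : IsSBull Cᶜ f)
  /-- Verdict `3`: array `2` gives an induced `U₁`. -/
  | u1 (f : U1 ↪g G)
      (verdict : σ.var 1 = 3)
      (clique : ∀ i : Fin 4, σ.arr 2 i = f (.inl i))
      (stable : ∀ j : Fin 3, σ.arr 2 (4 + j) = f (.inr j))
  /-- Verdict `4`: array `2` gives an induced `S₄`. -/
  | s4 (f : S4 ↪g G)
      (verdict : σ.var 1 = 4)
      (clique : ∀ i : Fin 6, σ.arr 2 i = f (.inl i))
      (stable : ∀ j : Fin 4, σ.arr 2 (6 + j) = f (.inr j))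

end EPG

/-! Necessity: the paths of the clique pairwise share an edge, so up to reflection at the diagonal
they all contain one vertical edge (`exists_covers`). Above it their arms are nested, so two stable
paths with incomparable clique neighbourhoods cannot both lie there (`not_above_of_private`). Yet of
the two stable paths of a gem one must lie there (`above_of_gem`). The overlapping gems of `U1` and
the two disjoint gems of `S4` make this impossible.

Sufficiency: let N(c) be the set of stable neighbours of a clique vertex c. Without an S-bull these
sets are laminar. Without `U1` no N(u) includes three pairwise disjoint nonempty members, and
without `S4` any two members that each include two disjoint nonempty members meet. If some member
includes disjoint nonempty N(a) and N(a'), fix such a pair and let `col` be the union of the members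
that meet N(a') but not N(a); otherwise let `col` be empty. Then the family is a chain on `col`, and
the rest of the stable set falls into classes such that each clique vertex sees at most one class
and the family is a chain on each (`chains_of_laminar`). A chain consists of initial segments of the
order by decreasing degree (`mem_iff_rank_lt`), so the length of an arm can encode a neighbourhood.
All clique paths bend in column 0 and contain the edge from (0, n) to (0, n+1); `col` is stacked
above this edge, and each class has its own row below it.

Algorithm: the verdict, the obstructions and the coordinates are all defined from the input by
quantifiers, counting and sums over vertices or tuples of fixed length. The predicate `PC` is closed
under these operations (`PC.sum`, `PC.sumTuple`), so exhaustive search is polynomial. Choices are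
made definable by lexicographic minimality. -/

namespace EPG

/-! ### Functions computable in polynomial time -/

/-- An input of the recognition problem. -/
structure Inst where
  n : ℕ
  G : SimpleGraph (Fin n)
  C : Set (Fin n)

/-- The program `p`, started in `σ`, halts in `τ` after at most `T` steps. -/
def Exec (p : Prog) (σ : Store) (T : ℕ) (τ : Store) : Prop := ∃ t ≤ T, Run p σ t τ

/-- The memory after the assignment of `k` to the variable `x`. -/
def Store.setVar (σ : Store) (x k : ℕ) : Store := ⟨Function.update σ.var x k, σ.arr⟩

/-- The memory after the assignment of `k` to the cell `i` of the array `a`. -/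
def Store.setArr (σ : Store) (a i k : ℕ) : Store :=
  ⟨σ.var, Function.update σ.arr a (Function.update (σ.arr a) i k)⟩

@[simp] theorem Store.setVar_var_self (σ : Store) (x k : ℕ) : (σ.setVar x k).var x = k := by
  simp [Store.setVar]

theorem Store.setVar_var_ne (σ : Store) {x y : ℕ} (k : ℕ) (h : y ≠ x) :
    (σ.setVar x k).var y = σ.var y := by
  simp [Store.setVar, h]

@[simp] theorem Store.setVar_arr (σ : Store) (x k : ℕ) : (σ.setVar x k).arr = σ.arr := rfl

@[simp] theorem Store.setArr_var (σ : Store) (a i k : ℕ) : (σ.setArr a i k).var = σ.var := rfl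

theorem Exec.mono {p : Prog} {σ τ : Store} {T T' : ℕ} (h : Exec p σ T τ) (hT : T ≤ T') :
    Exec p σ T' τ := by
  obtain ⟨t, ht, hr⟩ := h
  exact ⟨t, ht.trans hT, hr⟩

theorem Exec.assign (x : ℕ) (e : Expr) (σ : Store) :
    Exec (.assign x e) σ (e.cost + 1) (σ.setVar x (e.eval σ)) :=
  ⟨_, le_rfl, Run.assign x e σ⟩

theorem Exec.put (a : ℕ) (i e : Expr) (σ : Store) :
    Exec (.put a i e) σ (i.cost + e.cost + 1) (σ.setArr a (i.eval σ) (e.eval σ)) :=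
  ⟨_, le_rfl, Run.put a i e σ⟩

theorem Exec.seq {p q : Prog} {σ τ ρ : Store} {T₁ T₂ : ℕ} (h₁ : Exec p σ T₁ τ)
    (h₂ : Exec q τ T₂ ρ) : Exec (.seq p q) σ (T₁ + T₂) ρ := by
  obtain ⟨t₁, ht₁, hr₁⟩ := h₁
  obtain ⟨t₂, ht₂, hr₂⟩ := h₂
  exact ⟨_, add_le_add ht₁ ht₂, Run.seq hr₁ hr₂⟩

theorem Exec.iteTrue {b : Expr} {p q : Prog} {σ τ : Store} {T : ℕ} (hb : b.eval σ ≠ 0)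
    (h : Exec p σ T τ) : Exec (.ite b p q) σ (b.cost + 1 + T) τ := by
  obtain ⟨t, ht, hr⟩ := h
  exact ⟨_, add_le_add le_rfl ht, Run.iteTrue hb hr⟩

theorem Exec.iteFalse {b : Expr} {p q : Prog} {σ τ : Store} {T : ℕ} (hb : b.eval σ = 0)
    (h : Exec q σ T τ) : Exec (.ite b p q) σ (b.cost + 1 + T) τ := by
  obtain ⟨t, ht, hr⟩ := h
  exact ⟨_, add_le_add le_rfl ht, Run.iteFalse hb hr⟩

/-- for `x` from its current value to the value of variable `0` do `p` -/
def Prog.forLoop (x : ℕ) (p : Prog) : Prog :=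
  .loop (.lt (.var x) (.var 0)) (.seq p (.assign x (.add (.var x) (.lit 1))))

/-- Besides the body, a pass costs 4 steps for the test and 4 for the increment; the final 4 are the
failing test. The invariant refers to the memory after the increment, in which the next pass starts.
-/
theorem Exec.forLoop {n x T : ℕ} {p : Prog} (hx : x ≠ 0) (Inv : ℕ → Store → Prop)
    (step : ∀ i < n, ∀ σ : Store, σ.var 0 = n → σ.var x = i → Inv i σ →
      ∃ τ, Exec p σ T τ ∧ τ.var 0 = n ∧ τ.var x = i ∧ Inv (i + 1) (τ.setVar x (i + 1))) :
    ∀ σ : Store, σ.var 0 = n → σ.var x = 0 → Inv 0 σ →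
      ∃ τ, Exec (.forLoop x p) σ (n * (T + 8) + 4) τ ∧ τ.var 0 = n ∧ Inv n τ := by
  have key : ∀ k i, i + k = n → ∀ σ : Store, σ.var 0 = n → σ.var x = i → Inv i σ →
      ∃ τ, Exec (.forLoop x p) σ (k * (T + 8) + 4) τ ∧ τ.var 0 = n ∧ Inv n τ := by
    intro k
    induction k with
    | zero =>
      intro i hi σ h0 hxi hI
      refine ⟨σ, ⟨_, ?_, Run.loopFalse ?_⟩, h0, by simpa [← hi] using hI⟩
      · simp [Expr.cost]
      · exact if_neg (by simp only [Expr.eval]; omega)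
    | succ k ih =>
      intro i hi σ h0 hxi hI
      obtain ⟨τ, hE, hτ0, hτx, hτI⟩ := step i (by omega) σ h0 hxi hI
      have hE' := hE.seq (Exec.assign x (.add (.var x) (.lit 1)) τ)
      simp only [Expr.eval, hτx] at hE'
      obtain ⟨t₁, ht₁, hr₁⟩ := hE'
      obtain ⟨ρ, ⟨t₂, ht₂, hr₂⟩, hρ0, hρI⟩ := ih (i + 1) (by omega) (τ.setVar x (i + 1))
        (by rw [Store.setVar_var_ne _ _ hx.symm, hτ0]) (by simp) hτI
      refine ⟨ρ, ⟨_, ?_, Run.loopTrue ?_ hr₁ hr₂⟩, hρ0, hρI⟩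
      · simp only [Expr.cost] at ht₁ ⊢
        rw [Nat.succ_mul]
        omega
      · have : σ.var x < σ.var 0 := by omega
        simp [Expr.eval, this]
  intro σ h0 hx0 hI
  exact key n 0 (by omega) σ h0 hx0 hI

/-- A context: an input together with the values of finitely many variables. -/
class Ctx (Γ : Type) where
  inst : Γ → Inst
  len : ℕ
  val : ℕ → Γ → ℕ

open Ctx

/-- The memory `σ` holds the context `γ`, whose variables have the addresses `loc`. -/
structure Holds {Γ : Type} [Ctx Γ] (loc : ℕ → ℕ) (σ : Store) (γ : Γ) : Prop where
  size : σ.var 0 = (inst γ).n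
  adj : σ.arr 0 = (inputStore (inst γ).G (inst γ).C).arr 0
  mem : σ.arr 1 = (inputStore (inst γ).G (inst γ).C).arr 1
  val : ∀ i < len Γ, σ.var (loc i) = val i γ

/-- The memories `σ` and `τ` differ at most in the variables from `s` on. -/
structure SameBelow (s : ℕ) (σ τ : Store) : Prop where
  var : ∀ x < s, τ.var x = σ.var x
  arr : τ.arr = σ.arr

theorem SameBelow.refl (s : ℕ) (σ : Store) : SameBelow s σ σ := ⟨fun _ _ => rfl, rfl⟩

theorem SameBelow.trans {s : ℕ} {σ τ ρ : Store} (h₁ : SameBelow s σ τ) (h₂ : SameBelow s τ ρ) :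
    SameBelow s σ ρ :=
  ⟨fun x hx => (h₂.var x hx).trans (h₁.var x hx), h₂.arr.trans h₁.arr⟩

theorem SameBelow.mono {s s' : ℕ} {σ τ : Store} (h : SameBelow s' σ τ) (hs : s ≤ s') :
    SameBelow s σ τ :=
  ⟨fun x hx => h.var x (hx.trans_le hs), h.arr⟩

theorem SameBelow.setVar {s : ℕ} {σ τ : Store} (h : SameBelow s σ τ) {x : ℕ} (hx : s ≤ x)
    (k : ℕ) : SameBelow s σ (τ.setVar x k) :=
  ⟨fun y hy => by rw [Store.setVar_var_ne _ _ (by omega), h.var y hy], h.arr⟩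

theorem Holds.congr {Γ : Type} [Ctx Γ] {loc : ℕ → ℕ} {s : ℕ} {σ τ : Store} {γ : Γ}
    (h : Holds loc σ γ) (hs : 0 < s) (hloc : ∀ i < len Γ, loc i < s) (hE : SameBelow s σ τ) :
    Holds loc τ γ :=
  ⟨(hE.var 0 hs).trans h.size, by rw [hE.arr, h.adj], by rw [hE.arr, h.mem],
    fun i hi => (hE.var _ (hloc i hi)).trans (h.val i hi)⟩

/-- The function `f` of a context is computable in polynomial time: for any addresses of the
variables and any address `s` beyond them there is a program that puts the value of `f` into the
variable `s` and affects nothing but the variables from `s` on. -/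
def PC {Γ : Type} [Ctx Γ] (f : Γ → ℕ) : Prop :=
  ∀ (loc : ℕ → ℕ) (s : ℕ), 0 < s → (∀ i < len Γ, loc i < s) →
    ∃ (p : Prog) (q : Polynomial ℕ), ∀ (γ : Γ) (σ : Store), Holds loc σ γ →
      ∃ τ, Exec p σ (q.eval (inst γ).n) τ ∧ τ.var s = f γ ∧ SameBelow s σ τ

open Classical in
/-- The property `P` of a context is decidable in polynomial time. -/
def PCP {Γ : Type} [Ctx Γ] (P : Γ → Prop) : Prop := PC (fun γ => if P γ then 1 else 0)

/-- The vertex `v` is computable in polynomial time. -/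
def PCV {Γ : Type} [Ctx Γ] (v : (γ : Γ) → Fin (inst γ).n) : Prop := PC (fun γ => (v γ : ℕ))

/-! ### Closure properties of polynomial-time computability -/

section Closure

variable {Γ : Type} [Ctx Γ]

theorem PC.expr (e : Expr) (f : Γ → ℕ)
    (h : ∀ (loc : ℕ → ℕ) (σ : Store) (γ : Γ), Holds loc σ γ → e.eval σ = f γ) : PC f := by
  intro loc s hs hloc
  refine ⟨.assign s e, Polynomial.C (e.cost + 1), fun γ σ hσ => ⟨σ.setVar s (e.eval σ), ?_, ?_, ?_⟩⟩
  · simpa using Exec.assign s e σ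
  · simpa using h loc σ γ hσ
  · exact (SameBelow.refl s σ).setVar le_rfl _

theorem PC.const (k : ℕ) : PC (fun _ : Γ => k) := .expr (.lit k) _ fun _ _ _ _ => rfl

theorem PC.size : PC (fun γ : Γ => (inst γ).n) := .expr (.var 0) _ fun _ _ _ h => h.size

/-- The operation may depend on the context, so that reading an input array is an instance. -/
theorem PC.unary (E : Expr → Expr) (op : Γ → ℕ → ℕ)
    (hE : ∀ (e : Expr) (loc : ℕ → ℕ) (σ : Store) (γ : Γ), Holds loc σ γ →
      (E e).eval σ = op γ (e.eval σ))
    {f : Γ → ℕ} (hf : PC f) : PC (fun γ => op γ (f γ)) := by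
  intro loc s hs hloc
  obtain ⟨p, q, hp⟩ := hf loc s hs hloc
  refine ⟨.seq p (.assign s (E (.var s))), q + Polynomial.C ((E (.var s)).cost + 1), ?_⟩
  intro γ σ hσ
  obtain ⟨τ, hτ, hv, hS⟩ := hp γ σ hσ
  refine ⟨_, by simpa using hτ.seq (Exec.assign s (E (.var s)) τ), ?_, hS.setVar le_rfl _⟩
  rw [Store.setVar_var_self, hE _ loc τ γ (hσ.congr hs hloc hS), Expr.eval, hv]

theorem PC.binary (E : Expr → Expr → Expr) (op : ℕ → ℕ → ℕ)
    (hE : ∀ (e₁ e₂ : Expr) (σ : Store), (E e₁ e₂).eval σ = op (e₁.eval σ) (e₂.eval σ))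
    {f g : Γ → ℕ} (hf : PC f) (hg : PC g) : PC (fun γ => op (f γ) (g γ)) := by
  intro loc s hs hloc
  obtain ⟨p₁, q₁, hp₁⟩ := hf loc s hs hloc
  -- The second operand works from `s + 1` on, so the first value survives in `s`.
  obtain ⟨p₂, q₂, hp₂⟩ := hg loc (s + 1) (by omega) (fun i hi => (hloc i hi).trans (by omega))
  refine ⟨.seq p₁ (.seq p₂ (.assign s (E (.var s) (.var (s + 1))))),
    q₁ + (q₂ + Polynomial.C ((E (.var s) (.var (s + 1))).cost + 1)), ?_⟩
  intro γ σ hσ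
  obtain ⟨τ, hτ, hv, hS⟩ := hp₁ γ σ hσ
  obtain ⟨ρ, hρ, hw, hS'⟩ := hp₂ γ τ (hσ.congr hs hloc hS)
  refine ⟨_, by simpa using hτ.seq (hρ.seq (Exec.assign s (E (.var s) (.var (s + 1))) ρ)), ?_,
    (hS.trans (hS'.mono (by omega))).setVar le_rfl _⟩
  rw [Store.setVar_var_self, hE, Expr.eval, Expr.eval, hw, hS'.var s (by omega), hv]

theorem PC.add {f g : Γ → ℕ} (hf : PC f) (hg : PC g) : PC (fun γ => f γ + g γ) :=
  .binary .add (· + ·) (fun _ _ _ => rfl) hf hg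

theorem PC.sub {f g : Γ → ℕ} (hf : PC f) (hg : PC g) : PC (fun γ => f γ - g γ) :=
  .binary .sub (· - ·) (fun _ _ _ => rfl) hf hg

theorem PC.congr {f g : Γ → ℕ} (hf : PC f) (h : ∀ γ, f γ = g γ) : PC g := by
  rwa [← funext h]

theorem PC.eq {f g : Γ → ℕ} (hf : PC f) (hg : PC g) : PCP (fun γ => f γ = g γ) :=
  (PC.binary .eq (fun a b => if a = b then 1 else 0) (fun _ _ _ => rfl) hf hg).congr
    fun γ => by split_ifs <;> rfl

theorem PC.lt {f g : Γ → ℕ} (hf : PC f) (hg : PC g) : PCP (fun γ => f γ < g γ) :=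
  (PC.binary .lt (fun a b => if a < b then 1 else 0) (fun _ _ _ => rfl) hf hg).congr
    fun γ => by split_ifs <;> rfl

theorem PC.ite {P : Γ → Prop} {dec : ∀ γ, Decidable (P γ)} {f g : Γ → ℕ} (hP : PCP P) (hf : PC f)
    (hg : PC g) : PC (fun γ => if P γ then f γ else g γ) := by
  intro loc s hs hloc
  obtain ⟨p, q, hp⟩ := hP loc s hs hloc
  obtain ⟨p₁, q₁, hp₁⟩ := hf loc s hs hloc
  obtain ⟨p₂, q₂, hp₂⟩ := hg loc s hs hloc
  refine ⟨.seq p (.ite (.var s) p₁ p₂), q + (2 + q₁ + q₂), ?_⟩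
  intro γ σ hσ
  obtain ⟨τ, hτ, hv, hS⟩ := hp γ σ hσ
  by_cases h : P γ
  · obtain ⟨ρ, hρ, hw, hS'⟩ := hp₁ γ τ (hσ.congr hs hloc hS)
    refine ⟨ρ, (hτ.seq (Exec.iteTrue (b := .var s) (by simp [Expr.eval, hv, h]) hρ)).mono ?_,
      by simp [h, hw], hS.trans hS'⟩
    simp [Expr.cost]
  · obtain ⟨ρ, hρ, hw, hS'⟩ := hp₂ γ τ (hσ.congr hs hloc hS)
    refine ⟨ρ, (hτ.seq (Exec.iteFalse (b := .var s) (by simp [Expr.eval, hv, h]) hρ)).mono ?_,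
      by simp [h, hw], hS.trans hS'⟩
    simp [Expr.cost]

theorem PCP.congr {P Q : Γ → Prop} (hP : PCP P) (h : ∀ γ, P γ ↔ Q γ) : PCP Q := by
  rwa [← funext fun γ => propext (h γ)]

theorem PCP.const (P : Prop) : PCP (fun _ : Γ => P) := PC.const _

open Classical in
theorem PCP.not {P : Γ → Prop} (hP : PCP P) : PCP (fun γ => ¬ P γ) :=
  (PC.ite (dec := fun _ => propDecidable _) hP (PC.const 0) (PC.const 1)).congr fun γ => by
    by_cases h : P γ <;> simp [h]

open Classical in
theorem PCP.and {P Q : Γ → Prop} (hP : PCP P) (hQ : PCP Q) : PCP (fun γ => P γ ∧ Q γ) :=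
  (PC.ite (dec := fun _ => propDecidable _) hP hQ (PC.const 0)).congr fun γ => by
    by_cases h : P γ <;> by_cases h' : Q γ <;> simp [h, h']

open Classical in
theorem PCP.or {P Q : Γ → Prop} (hP : PCP P) (hQ : PCP Q) : PCP (fun γ => P γ ∨ Q γ) :=
  (PC.ite (dec := fun _ => propDecidable _) hP (PC.const 1) hQ).congr fun γ => by
    by_cases h : P γ <;> by_cases h' : Q γ <;> simp [h, h']

theorem PCP.imp {P Q : Γ → Prop} (hP : PCP P) (hQ : PCP Q) : PCP (fun γ => P γ → Q γ) :=
  (hP.not.or hQ).congr fun _ => imp_iff_not_or.symm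

theorem PCP.iff {P Q : Γ → Prop} (hP : PCP P) (hQ : PCP Q) : PCP (fun γ => P γ ↔ Q γ) :=
  ((hP.imp hQ).and (hQ.imp hP)).congr fun _ => iff_iff_implies_and_implies.symm

/-- Quantification over a finite set that does not depend on the input. -/
theorem PCP.forall_fin {k : ℕ} {P : Fin k → Γ → Prop} (hP : ∀ i, PCP (P i)) :
    PCP (fun γ => ∀ i, P i γ) := by
  induction k with
  | zero => exact (PCP.const True).congr fun γ => by simp
  | succ k ih =>
    exact ((hP 0).and (ih fun i => hP i.succ)).congr fun γ => (Fin.forall_fin_succ (P := (P · γ))).symm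

theorem PCP.exists_fin {k : ℕ} {P : Fin k → Γ → Prop} (hP : ∀ i, PCP (P i)) :
    PCP (fun γ => ∃ i, P i γ) :=
  (PCP.forall_fin fun i => (hP i).not).not.congr fun γ => by simp

theorem PC.sum_fin {k : ℕ} {f : Fin k → Γ → ℕ} (hf : ∀ i, PC (f i)) :
    PC (fun γ => ∑ i, f i γ) := by
  induction k with
  | zero => exact (PC.const 0).congr fun γ => by simp
  | succ k ih =>
    exact ((hf 0).add (ih fun i => hf i.succ)).congr fun γ => (Fin.sum_univ_succ (f · γ)).symm

/-- The extension of a context by a vertex. -/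
instance vertexCtx : Ctx ((γ : Γ) × Fin (inst γ).n) where
  inst p := inst p.1
  len := len Γ + 1
  val i p := if i < len Γ then val i p.1 else p.2

/-- The extension of a context by a tuple of vertices. -/
instance tupleCtx {k : ℕ} : Ctx ((γ : Γ) × (Fin k → Fin (inst γ).n)) where
  inst p := inst p.1
  len := len Γ + k
  val i p := if i < len Γ then val i p.1 else if h : i - len Γ < k then p.2 ⟨i - len Γ, h⟩ else 0

theorem PC.fst {f : Γ → ℕ} (hf : PC f) :
    PC (fun p : (γ : Γ) × Fin (inst γ).n => f p.1) := by
  intro loc s hs hloc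
  obtain ⟨p, q, hp⟩ := hf loc s hs fun i hi => hloc i (Nat.lt_succ_of_lt hi)
  refine ⟨p, q, fun γ σ hσ => hp γ.1 σ ⟨hσ.size, hσ.adj, hσ.mem, fun i hi => ?_⟩⟩
  have := hσ.val i (Nat.lt_succ_of_lt hi)
  simpa [Ctx.val, hi] using this

theorem PCV.fst {v : (γ : Γ) → Fin (inst γ).n} (hv : PCV v) :
    PCV (fun p : (γ : Γ) × Fin (inst γ).n => v p.1) := PC.fst hv

theorem PC.fstTuple {k : ℕ} {f : Γ → ℕ} (hf : PC f) :
    PC (fun p : (γ : Γ) × (Fin k → Fin (inst γ).n) => f p.1) := by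
  intro loc s hs hloc
  obtain ⟨p, q, hp⟩ := hf loc s hs fun i hi => hloc i (Nat.lt_add_right k hi)
  refine ⟨p, q, fun γ σ hσ => hp γ.1 σ ⟨hσ.size, hσ.adj, hσ.mem, fun i hi => ?_⟩⟩
  have := hσ.val i (Nat.lt_add_right k hi)
  simpa [Ctx.val, hi] using this

theorem PCV.fstTuple {k : ℕ} {v : (γ : Γ) → Fin (inst γ).n} (hv : PCV v) :
    PCV (fun p : (γ : Γ) × (Fin k → Fin (inst γ).n) => v p.1) := PC.fstTuple hv

theorem PC.var {i : ℕ} (hi : i < len Γ) : PC (fun γ : Γ => val i γ) := by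
  intro loc s hs hloc
  refine ⟨.assign s (.var (loc i)), Polynomial.C 2, fun γ σ hσ => ⟨σ.setVar s (σ.var (loc i)),
    by simpa [Expr.cost, Expr.eval] using Exec.assign s (.var (loc i)) σ, ?_,
    (SameBelow.refl s σ).setVar le_rfl _⟩⟩
  simpa using hσ.val i hi

theorem PCV.snd : PCV (fun p : (γ : Γ) × Fin (inst γ).n => p.2) :=
  (PC.var (Γ := (γ : Γ) × Fin (inst γ).n) (Nat.lt_succ_self (len Γ))).congr fun p => by
    simp [Ctx.val]

theorem PCV.coord {k : ℕ} (i : Fin k) :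
    PCV (fun p : (γ : Γ) × (Fin k → Fin (inst γ).n) => p.2 i) :=
  (PC.var (Γ := (γ : Γ) × (Fin k → Fin (inst γ).n)) (i := len Γ + i)
    (Nat.add_lt_add_left i.2 _)).congr fun p => by simp [Ctx.val]

theorem PC.sum {f : (γ : Γ) → Fin (inst γ).n → ℕ}
    (hf : PC (fun p : (γ : Γ) × Fin (inst γ).n => f p.1 p.2)) :
    PC (fun γ => ∑ v, f γ v) := by
  intro loc s hs hloc
  -- The sum accumulates in `s`, the counter `s + 1` doubles as the address of the bound vertex, and
  -- the summand is computed from `s + 2` on.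
  obtain ⟨p, q, hp⟩ := hf (Function.update loc (len Γ) (s + 1)) (s + 2) (by omega) (by
    intro i hi
    rcases Nat.lt_succ_iff_lt_or_eq.1 hi with hi | rfl
    · rw [Function.update_of_ne hi.ne]
      exact (hloc i hi).trans (by omega)
    · simp)
  refine ⟨.seq (.assign s (.lit 0)) (.seq (.assign (s + 1) (.lit 0)) (.forLoop (s + 1)
    (.seq p (.assign s (.add (.var s) (.var (s + 2))))))),
    2 + (2 + (Polynomial.X * (q + 4 + 8) + 4)), ?_⟩
  intro γ σ hσ
  set n := (inst γ).n with hn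
  obtain ⟨τ, hτ, -, hv, hS⟩ := Exec.forLoop (n := n) (x := s + 1) (T := q.eval n + 4)
    (p := .seq p (.assign s (.add (.var s) (.var (s + 2))))) (by omega)
    (fun i τ => τ.var s = ∑ v : Fin n, (if (v : ℕ) < i then f γ v else 0) ∧ SameBelow s σ τ)
    (by
      intro i hi τ _ hτx hτ
      obtain ⟨hv, hS⟩ := hτ
      have hτ : Holds loc τ γ := hσ.congr hs hloc hS
      obtain ⟨ρ, hρ, hw, hS'⟩ := hp ⟨γ, ⟨i, hi⟩⟩ τ ⟨hτ.size, hτ.adj, hτ.mem, by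
        intro j hj
        rcases Nat.lt_succ_iff_lt_or_eq.1 hj with hj | rfl
        · rw [Function.update_of_ne hj.ne, hτ.val j hj]
          simp [Ctx.val, hj]
        · simp [Ctx.val, hτx]⟩
      refine ⟨_, (hρ.seq (Exec.assign s (.add (.var s) (.var (s + 2))) ρ)).mono ?_, ?_, ?_, ?_, ?_⟩
      · simp only [Expr.cost]; exact le_rfl
      · rw [Store.setVar_var_ne _ _ (by omega), hS'.var 0 (by omega), hτ.size]
      · rw [Store.setVar_var_ne _ _ (by omega), hS'.var _ (by omega), hτx]
      · rw [Store.setVar_var_ne _ _ (by omega), Store.setVar_var_self]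
        simp only [Expr.eval]
        rw [hw, hS'.var s (by omega), hv,
          ← Finset.sum_erase_add _ _ (Finset.mem_univ (⟨i, hi⟩ : Fin n)),
          ← Finset.sum_erase_add (a := (⟨i, hi⟩ : Fin n)) _ _ (Finset.mem_univ _)]
        simp only [lt_irrefl, if_false, add_zero, Nat.lt_succ_self, if_true]
        congr 1
        refine Finset.sum_congr rfl fun v hv => ?_
        have : (v : ℕ) ≠ i := fun h => (Finset.mem_erase.1 hv).1 (Fin.ext h)
        exact if_congr (by omega) rfl rfl
      · exact ((hS.trans (hS'.mono (by omega))).setVar le_rfl _).setVar (by omega) _)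
    ((σ.setVar s 0).setVar (s + 1) 0)
    (by rw [Store.setVar_var_ne _ _ (by omega), Store.setVar_var_ne _ _ (by omega), hσ.size])
    (by simp)
    ⟨by rw [Store.setVar_var_ne _ _ (by omega)]; simp,
      ((SameBelow.refl s σ).setVar le_rfl _).setVar (by omega) _⟩
  refine ⟨τ, ((Exec.assign s (.lit 0) σ).seq ((Exec.assign (s + 1) (.lit 0) _).seq hτ)).mono ?_,
    ?_, hS⟩
  · simp [Expr.cost]
  · rw [hv]
    exact Finset.sum_congr rfl fun v _ => if_pos v.2

open Classical in
theorem PCP.exists {P : (γ : Γ) → Fin (inst γ).n → Prop}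
    (hP : PCP (fun p : (γ : Γ) × Fin (inst γ).n => P p.1 p.2)) : PCP (fun γ => ∃ v, P γ v) :=
  (PC.lt (PC.const 0) (PC.sum (f := fun γ v => if P γ v then 1 else 0) hP)).congr fun γ => by
    simp [Nat.pos_iff_ne_zero]

theorem PCP.forall {P : (γ : Γ) → Fin (inst γ).n → Prop}
    (hP : PCP (fun p : (γ : Γ) × Fin (inst γ).n => P p.1 p.2)) : PCP (fun γ => ∀ v, P γ v) :=
  (PCP.exists (P := fun γ v => ¬ P γ v) hP.not).not.congr fun γ => by simp

theorem PC.card {P : (γ : Γ) → Fin (inst γ).n → Prop} {_ : ∀ γ, DecidablePred (P γ)}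
    (hP : PCP (fun p : (γ : Γ) × Fin (inst γ).n => P p.1 p.2)) :
    PC (fun γ => (Finset.univ.filter (P γ)).card) :=
  (PC.sum (f := fun γ v => if P γ v then 1 else 0) (PC.ite hP (PC.const 1) (PC.const 0))).congr
    fun γ => by simp

/-- A change of the context that keeps the values of all variables. -/
theorem PC.comp {Δ : Type} [Ctx Δ] {f : Γ → ℕ} (hf : PC f) (φ : Δ → Γ)
    (hi : ∀ δ, inst (φ δ) = inst δ) (hl : len Δ = len Γ)
    (hv : ∀ i < len Γ, ∀ δ, val i (φ δ) = val i δ) : PC (fun δ => f (φ δ)) := by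
  intro loc s hs hloc
  obtain ⟨p, q, hp⟩ := hf loc s hs (hl ▸ hloc)
  refine ⟨p, q, fun δ σ hσ => ?_⟩
  rw [← hi]
  exact hp (φ δ) σ ⟨by rw [hσ.size, hi], by rw [hσ.adj, hi], by rw [hσ.mem, hi],
    fun i h => by rw [hσ.val i (hl ▸ h), hv i h]⟩

/-- A sum over tuples is iterated over the last entry. A tuple followed by a vertex and the longer
tuple store the same variables in the same order, so `PC.comp` identifies the contexts. -/
theorem PC.sumTuple {k : ℕ} {f : (γ : Γ) → (Fin k → Fin (inst γ).n) → ℕ}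
    (hf : PC (fun p : (γ : Γ) × (Fin k → Fin (inst γ).n) => f p.1 p.2)) :
    PC (fun γ => ∑ x, f γ x) := by
  induction k with
  | zero =>
    refine (hf.comp (fun γ : Γ => ⟨γ, Fin.elim0⟩) (fun _ => rfl) rfl fun i hi γ => ?_).congr
      fun γ => ?_
    · have hi : i < len Γ := hi
      simp [Ctx.val, hi]
    · rw [Fintype.sum_unique]
      exact congrArg _ (Subsingleton.elim _ _)
  | succ k ih =>
    have h := hf.comp (fun p : (p : (γ : Γ) × (Fin k → Fin (inst γ).n)) × Fin (inst p).n =>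
      ⟨p.1.1, Fin.snoc (α := fun _ => Fin (inst p.1.1).n) p.1.2 p.2⟩) (fun _ => rfl) rfl (by
        intro i hi p
        have hi : i < len Γ + (k + 1) := hi
        by_cases h₁ : i < len Γ
        · have h₂ : i < len Γ + k := by omega
          simp [Ctx.val, Ctx.len, h₁, h₂]
        · by_cases h₂ : i < len Γ + k
          · have h₃ : i - len Γ < k := by omega
            have h₄ : i - len Γ < k + 1 := by omega
            simp [Ctx.val, Ctx.len, h₁, h₂, h₃, h₄, Fin.snoc]
          · have h₃ : ¬ i - len Γ < k := by omega
            have h₄ : i - len Γ < k + 1 := by omega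
            simp [Ctx.val, Ctx.len, h₁, h₂, h₃, h₄, Fin.snoc])
    refine (ih (f := fun γ x => ∑ v, f γ (Fin.snoc (α := fun _ => Fin (inst γ).n) x v))
      (PC.sum (Γ := (γ : Γ) × (Fin k → Fin (inst γ).n))
        (f := fun p v => f p.1 (Fin.snoc (α := fun _ => Fin (inst p.1).n) p.2 v)) h)).congr
      fun γ => ?_
    rw [← (Fin.snocEquiv fun _ => Fin (inst γ).n).sum_comp, Fintype.sum_prod_type,
      Finset.sum_comm]
    rfl

open Classical in
theorem PCP.existsTuple {k : ℕ} {P : (γ : Γ) → (Fin k → Fin (inst γ).n) → Prop}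
    (hP : PCP (fun p : (γ : Γ) × (Fin k → Fin (inst γ).n) => P p.1 p.2)) :
    PCP (fun γ => ∃ x, P γ x) :=
  (PC.lt (PC.const 0) (PC.sumTuple (f := fun γ v => if P γ v then 1 else 0) hP)).congr
    fun γ => by simp [Nat.pos_iff_ne_zero]

theorem PCP.forallTuple {k : ℕ} {P : (γ : Γ) → (Fin k → Fin (inst γ).n) → Prop}
    (hP : PCP (fun p : (γ : Γ) × (Fin k → Fin (inst γ).n) => P p.1 p.2)) :
    PCP (fun γ => ∀ x, P γ x) :=
  (PCP.existsTuple (P := fun γ v => ¬ P γ v) hP.not).not.congr fun γ => by simp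

theorem PCV.eq {v w : (γ : Γ) → Fin (inst γ).n} (hv : PCV v) (hw : PCV w) :
    PCP (fun γ => v γ = w γ) :=
  (PC.eq hv hw).congr fun _ => Fin.ext_iff.symm

theorem PCV.lt {v w : (γ : Γ) → Fin (inst γ).n} (hv : PCV v) (hw : PCV w) :
    PCP (fun γ => v γ < w γ) := PC.lt hv hw

theorem PCV.mem {v : (γ : Γ) → Fin (inst γ).n} (hv : PCV v) :
    PCP (fun γ => v γ ∈ (inst γ).C) :=
  (PC.unary (.get 1) (fun γ => (inputStore (inst γ).G (inst γ).C).arr 1)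
    (fun e loc σ γ h => by simp only [Expr.eval, h.mem]) hv).congr fun γ => by
      have : (∃ i : Fin (inst γ).n, (v γ : ℕ) = i ∧ i ∈ (inst γ).C) ↔ v γ ∈ (inst γ).C :=
        ⟨fun ⟨i, h, hi⟩ => Fin.ext h ▸ hi, fun h => ⟨_, rfl, h⟩⟩
      by_cases h : v γ ∈ (inst γ).C <;> simp [inputStore, this, h]

theorem inputStore_adj {n : ℕ} (G : SimpleGraph (Fin n)) (C : Set (Fin n)) (v w : Fin n)
    [Decidable (G.Adj v w)] :
    (inputStore G C).arr 0 (v * n + w) = if G.Adj v w then 1 else 0 := by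
  have : (∃ i j : Fin n, (v * n + w : ℕ) = i * n + j ∧ G.Adj i j) ↔ G.Adj v w := by
    refine ⟨?_, fun h => ⟨v, w, rfl, h⟩⟩
    rintro ⟨i, j, h, hij⟩
    have hn : 0 < n := v.pos
    have h₁ : (v : ℕ) = i := by
      have := congrArg (· / n) h
      simpa [Nat.add_comm, Nat.add_mul_div_right _ _ hn, Nat.div_eq_of_lt] using this
    have h₂ : (w : ℕ) = j := by rw [h₁] at h; omega
    rwa [Fin.ext h₁, Fin.ext h₂]
  simp only [inputStore, if_true, this]

open Classical in
theorem PCV.adj {v w : (γ : Γ) → Fin (inst γ).n} (hv : PCV v) (hw : PCV w) :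
    PCP (fun γ => (inst γ).G.Adj (v γ) (w γ)) :=
  (PC.unary (.get 0) (fun γ => (inputStore (inst γ).G (inst γ).C).arr 0)
    (fun e loc σ γ h => by simp only [Expr.eval, h.adj])
    -- In the absence of multiplication, `v * n` is the sum of the constant `v` over all vertices.
    ((PC.sum (f := fun γ _ => (v γ : ℕ)) (PC.fst hv)).add hw)).congr fun γ => by
      rw [← inputStore_adj (inst γ).G (inst γ).C]
      simp [Nat.mul_comm]

end Closure

/-- The context that consists of the input alone. -/
instance instCtx : Ctx Inst where
  inst I := I
  len := 0
  val _ _ := 0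

/-- A computable function of the vertices can be written into an array in polynomial time. -/
theorem PC.exists_writeArr {f : (I : Inst) → Fin I.n → ℕ}
    (hf : PC (fun p : (I : Inst) × Fin (inst I).n => f p.1 p.2)) {a : ℕ} (ha : 1 < a) :
    ∃ (p : Prog) (q : Polynomial ℕ), ∀ (I : Inst) (σ : Store), Holds (fun _ => 0) σ I →
      ∃ τ, Exec p σ (q.eval I.n) τ ∧ (∀ v : Fin I.n, τ.arr a v = f I v) ∧ (∀ b, b ≠ a → τ.arr b = σ.arr b) ∧
        τ.var 1 = σ.var 1 ∧ Holds (fun _ => 0) τ I := by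
  -- Variables 0 and 1 are reserved for the size and the verdict; 2 is the counter and 3 receives
  -- the value.
  obtain ⟨p, q, hp⟩ := hf (fun _ => 2) 3 (by omega) (fun _ _ => by omega)
  refine ⟨.seq (.assign 2 (.lit 0)) (.forLoop 2 (.seq p (.put a (.var 2) (.var 3)))),
    2 + (Polynomial.X * (q + 3 + 8) + 4), ?_⟩
  intro I σ hσ
  have harr {σ' : Store} (hn : σ'.var 0 = I.n) (h : ∀ b, b ≠ a → σ'.arr b = σ.arr b) :
      Holds (fun _ => 0) σ' I :=
    ⟨hn, (h 0 (by omega)).trans hσ.adj, (h 1 (by omega)).trans hσ.mem,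
      fun i hi => absurd hi (Nat.not_lt_zero i)⟩
  obtain ⟨τ, hτ, hn, hv, hb, h1⟩ := Exec.forLoop (n := I.n) (x := 2) (T := q.eval I.n + 3)
    (p := .seq p (.put a (.var 2) (.var 3))) (by omega)
    (fun i τ => (∀ v : Fin I.n, (v : ℕ) < i → τ.arr a v = f I v) ∧
      (∀ b, b ≠ a → τ.arr b = σ.arr b) ∧ τ.var 1 = σ.var 1)
    (by
      rintro i hi τ hn hx ⟨hv, hb, h1⟩
      have hτ := harr hn hb
      obtain ⟨ρ, hρ, hw, hS⟩ := hp ⟨I, ⟨i, hi⟩⟩ τ ⟨hn, hτ.adj, hτ.mem, fun j hj => by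
        have hj : j < 0 + 1 := hj
        obtain rfl : j = 0 := by omega
        simp [Ctx.val, Ctx.len, hx]⟩
      have hρ2 : ρ.var 2 = i := by rw [hS.var 2 (by omega), hx]
      refine ⟨_, (hρ.seq (Exec.put a (.var 2) (.var 3) ρ)).mono le_rfl, ?_, ?_, ?_, ?_, ?_⟩
      · rw [Store.setArr_var, hS.var 0 (by omega), hn]
      · rw [Store.setArr_var, hρ2]
      · intro v hvi
        simp only [Store.setVar_arr, Store.setArr, Expr.eval, hw, hρ2, Function.update_self, hS.arr]
        rcases Nat.lt_succ_iff_lt_or_eq.1 hvi with h | h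
        · rw [Function.update_of_ne h.ne, hv v h]
        · rw [h, Function.update_self]
          exact congrArg _ (Fin.ext h.symm)
      · intro b hne
        simp only [Store.setVar_arr, Store.setArr, Function.update_of_ne hne, hS.arr, hb b hne]
      · rw [Store.setVar_var_ne _ _ (by omega), Store.setArr_var, hS.var 1 (by omega), h1])
    (σ.setVar 2 0) (by rw [Store.setVar_var_ne _ _ (by omega)]; exact hσ.size) (by simp)
    ⟨fun _ h => absurd h (Nat.not_lt_zero _), fun _ _ => rfl,
      Store.setVar_var_ne _ _ (by omega)⟩
  refine ⟨τ, ((Exec.assign 2 (.lit 0) σ).seq hτ).mono ?_, fun v => hv v v.2, hb, h1, harr hn hb⟩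
  simp [Expr.cost]

end EPG


namespace EPG

/-! ### The obstructions have no `⌞`-representation -/

/-- Two paths share a vertical grid edge. -/
def VShare (P Q : LPath) : Prop :=
  P.bend.1 = Q.bend.1 ∧ 0 < P.up ∧ 0 < Q.up ∧ P.bend.2 < Q.bend.2 + Q.up ∧
    Q.bend.2 < P.bend.2 + P.up

/-- Two paths share a horizontal grid edge. -/
def HShare (P Q : LPath) : Prop :=
  P.bend.2 = Q.bend.2 ∧ 0 < P.right ∧ 0 < Q.right ∧ P.bend.1 < Q.bend.1 + Q.right ∧
    Q.bend.1 < P.bend.1 + P.right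

/-- Two paths share a grid edge. -/
def Share (P Q : LPath) : Prop := VShare P Q ∨ HShare P Q

/-- Overlapping parallel arms share the edge that starts at the later of the two bend points. -/
theorem edges_inter_nonempty_iff (P Q : LPath) :
    (P.edges ∩ Q.edges).Nonempty ↔ Share P Q := by
  constructor
  · rintro ⟨e, ⟨i, hi, rfl⟩ | ⟨i, hi, rfl⟩, ⟨j, hj, h⟩ | ⟨j, hj, h⟩⟩ <;>
      simp only [Sym2.eq_iff, Prod.mk.injEq] at h
    · exact .inl ⟨by omega, by omega, by omega, by omega, by omega⟩
    · omega
    · omega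
    · exact .inr ⟨by omega, by omega, by omega, by omega, by omega⟩
  · rintro (⟨h₁, h₂, h₃, h₄, h₅⟩ | ⟨h₁, h₂, h₃, h₄, h₅⟩)
    · rcases le_total P.bend.2 Q.bend.2 with h | h
      · refine ⟨_, .inl ⟨(Q.bend.2 - P.bend.2).toNat, by omega, rfl⟩, .inl ⟨0, h₃, ?_⟩⟩
        simp only [Sym2.eq_iff, Prod.mk.injEq]
        omega
      · refine ⟨_, .inl ⟨0, h₂, rfl⟩, .inl ⟨(P.bend.2 - Q.bend.2).toNat, by omega, ?_⟩⟩
        simp only [Sym2.eq_iff, Prod.mk.injEq]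
        omega
    · rcases le_total P.bend.1 Q.bend.1 with h | h
      · refine ⟨_, .inr ⟨(Q.bend.1 - P.bend.1).toNat, by omega, rfl⟩, .inr ⟨0, h₃, ?_⟩⟩
        simp only [Sym2.eq_iff, Prod.mk.injEq]
        omega
      · refine ⟨_, .inr ⟨0, h₂, rfl⟩, .inr ⟨(P.bend.1 - Q.bend.1).toNat, by omega, ?_⟩⟩
        simp only [Sym2.eq_iff, Prod.mk.injEq]
        omega

theorem share_self (P : LPath) : Share P P := by
  rcases P.nontrivial with h | h
  · exact .inl ⟨rfl, h, h, by omega, by omega⟩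
  · exact .inr ⟨rfl, h, h, by omega, by omega⟩

/-- The reflection at the diagonal. -/
def LPath.swap (P : LPath) : LPath := ⟨P.bend.swap, P.right, P.up, P.nontrivial.symm⟩

theorem share_swap (P Q : LPath) : Share P.swap Q.swap ↔ Share P Q := or_comm

/-- The path contains the vertical grid edge that runs upwards from the point `(x, m)`. -/
def LPath.Covers (x m : ℤ) (P : LPath) : Prop :=
  P.bend.1 = x ∧ P.bend.2 ≤ m ∧ m < P.bend.2 + P.up

/-- Helly property of intervals: the edge above the highest bend point is common. -/
theorem exists_covers_of_vShare {ι : Type*} [Finite ι] [Nonempty ι] {c : ι → LPath}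
    (h : ∀ i j, VShare (c i) (c j)) : ∃ x m, ∀ i, (c i).Covers x m := by
  obtain ⟨i, hi⟩ := Finite.exists_max fun i => (c i).bend.2
  exact ⟨(c i).bend.1, (c i).bend.2, fun j => ⟨(h j i).1, hi j, (h j i).2.2.2.2⟩⟩

/-- Pairwise intersecting `⌞`-paths have a common grid edge, which is vertical up to reflection. -/
theorem exists_covers {ι : Type*} [Finite ι] [Nonempty ι] {c : ι → LPath}
    (h : ∀ i j, Share (c i) (c j)) :
    (∃ x m, ∀ i, (c i).Covers x m) ∨ ∃ x m, ∀ i, (c i).swap.Covers x m := by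
  -- Suppose that `i`, `j` share only a horizontal edge and `k`, `l` only a vertical one. If `i` and
  -- `j` bend in different columns, then each of `k`, `l` shares a horizontal edge with one of them.
  -- If they bend at the same point, one has no vertical arm and hence shares horizontal edges with
  -- both `k` and `l`. Either way `k` and `l` have the same bend point and nonempty horizontal arms,
  -- a contradiction.
  have key : (∀ i j, VShare (c i) (c j)) ∨ ∀ i j, HShare (c i) (c j) := by
    by_contra! hcon
    obtain ⟨⟨i, j, hV⟩, k, l, hH⟩ := hcon
    have h₁ := (h i j).resolve_left hV
    have h₂ := (h k l).resolve_right hH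
    have h₃ := h i k
    have h₄ := h i l
    have h₅ := h j k
    have h₆ := h j l
    simp only [Share, VShare, HShare] at *
    rcases h₃ with h₃ | h₃ <;> rcases h₄ with h₄ | h₄ <;> rcases h₅ with h₅ | h₅ <;>
      rcases h₆ with h₆ | h₆ <;> omega
  exact key.imp exists_covers_of_vShare
    fun h => exists_covers_of_vShare (c := fun i => (c i).swap) h

/-- The vertical arm of the path lies in the column `x` above the height `m`. -/
def LPath.Above (x m : ℤ) (P : LPath) : Prop := P.bend.1 = x ∧ m < P.bend.2 ∧ 0 < P.up

/-- A path above `m` meets `c` or `c'` only in column `x`, where the longer of their arms meets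
everything above `m` that the other one meets. -/
theorem not_above_of_private {x m : ℤ} {c c' s s' : LPath} (hc : c.Covers x m)
    (hc' : c'.Covers x m) (hs : Share c s) (hs' : Share c' s') (h : ¬ Share c s')
    (h' : ¬ Share c' s) (ha : s.Above x m) : ¬ s'.Above x m := by
  intro ha'
  simp only [Share, VShare, HShare, LPath.Covers, LPath.Above] at *
  omega

/-- Neither `s` nor `s'` contains the common edge, since each misses a clique path. If neither is
above it, their contacts lie below it or in horizontal arms. If both have contacts below, the arms
of `a`, `a'` are nested there; if both are horizontal, `a`, `b`, `a'` have one bend point and nested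
arms. In the mixed case `b` has the same bend point as `a` or `a'`, which then also reaches the path
that it should miss. -/
theorem above_of_gem {x m : ℤ} {a b a' s s' : LPath} (ha : a.Covers x m) (hb : b.Covers x m)
    (ha' : a'.Covers x m) (h₁ : Share a s) (h₂ : Share b s) (h₃ : ¬ Share a' s)
    (h₄ : ¬ Share a s') (h₅ : Share b s') (h₆ : Share a' s') :
    s.Above x m ∨ s'.Above x m := by
  by_contra! hcon
  obtain ⟨hs, hs'⟩ := hcon
  simp only [Share, VShare, HShare, LPath.Covers, LPath.Above] at *
  rcases h₁ with h₁ | h₁ <;> rcases h₂ with h₂ | h₂ <;> rcases h₅ with h₅ | h₅ <;>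
    rcases h₆ with h₆ | h₆ <;> omega

/-- Any two stable vertices form a gem with the universal vertex `0`, so two of the three paths
would lie above; their private neighbours allow only one. -/
theorem not_u1_of_covers {x m : ℤ} {c : Fin 4 → LPath} {s : Fin 3 → LPath}
    (hc : ∀ i, (c i).Covers x m)
    (h : ∀ i j, Share (c i) (s j) ↔ U1.Adj (.inl i) (.inr j)) : False := by
  have gem (i j : Fin 3) (hij : i ≠ j) : (s i).Above x m ∨ (s j).Above x m := by
    refine above_of_gem (hc i.succ) (hc 0) (hc j.succ) ?_ ?_ ?_ ?_ ?_ ?_ <;> rw [h] <;>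
      revert hij <;> revert i j <;> unfold U1 splitGraph <;> decide
  have above (i j : Fin 3) (hij : i ≠ j) (ha : (s i).Above x m) : ¬ (s j).Above x m := by
    refine not_above_of_private (hc i.succ) (hc j.succ) ?_ ?_ ?_ ?_ ha <;> rw [h] <;>
      clear ha <;> revert hij <;> revert i j <;> unfold U1 splitGraph <;> decide
  have h₁ := gem 0 1 (by decide)
  have h₂ := gem 1 2 (by decide)
  have h₃ := gem 0 2 (by decide)
  have h₄ := above 0 1 (by decide)
  have h₅ := above 1 2 (by decide)
  have h₆ := above 0 2 (by decide)
  tauto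

/-- Each gem has a path above, and the gem centres `1` and `4` are private neighbours of these two
paths. -/
theorem not_s4_of_covers {x m : ℤ} {c : Fin 6 → LPath} {s : Fin 4 → LPath}
    (hc : ∀ i, (c i).Covers x m)
    (h : ∀ i j, Share (c i) (s j) ↔ S4.Adj (.inl i) (.inr j)) : False := by
  have h₁ : (s 0).Above x m ∨ (s 1).Above x m := by
    refine above_of_gem (hc 0) (hc 1) (hc 2) ?_ ?_ ?_ ?_ ?_ ?_ <;> rw [h] <;>
      unfold S4 splitGraph <;> decide
  have h₂ : (s 2).Above x m ∨ (s 3).Above x m := by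
    refine above_of_gem (hc 3) (hc 4) (hc 5) ?_ ?_ ?_ ?_ ?_ ?_ <;> rw [h] <;>
      unfold S4 splitGraph <;> decide
  have above (i j : Fin 4) (hi : i < 2) (hj : 2 ≤ j) (ha : (s i).Above x m) :
      ¬ (s j).Above x m := by
    refine not_above_of_private (hc 1) (hc 4) ?_ ?_ ?_ ?_ ha <;> rw [h] <;>
      clear ha <;> revert i j <;> unfold S4 splitGraph <;> decide
  rcases h₁ with h₁ | h₁ <;> rcases h₂ with h₂ | h₂ <;>
    exact above _ _ (by decide) (by decide) h₁ h₂

theorem share_iff_of_rep {W : Type*} {H : SimpleGraph W} {P : W → LPath}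
    (hP : IsLRepresentation H P) {u v : W} (huv : u ≠ v) : Share (P u) (P v) ↔ H.Adj u v := by
  rw [hP u v huv, edges_inter_nonempty_iff]

theorem share_splitGraph {c s : ℕ} {N : Fin s → Finset (Fin c)} {P : Fin c ⊕ Fin s → LPath}
    (hP : IsLRepresentation (splitGraph c s N) P) (i j : Fin c) :
    Share (P (.inl i)) (P (.inl j)) := by
  by_cases hij : i = j
  · exact hij ▸ share_self _
  · exact (share_iff_of_rep hP (by simpa using hij)).2 hij

theorem not_isLRepresentation_U1 (P : Fin 4 ⊕ Fin 3 → LPath) : ¬ IsLRepresentation U1 P := by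
  intro hP
  rcases exists_covers (c := fun i => P (.inl i)) (share_splitGraph hP) with
    ⟨x, m, hc⟩ | ⟨x, m, hc⟩
  · exact not_u1_of_covers hc (s := fun j => P (.inr j))
      fun i j => share_iff_of_rep hP (by simp)
  · exact not_u1_of_covers hc (s := fun j => (P (.inr j)).swap)
      fun i j => (share_swap _ _).trans (share_iff_of_rep hP (by simp))

theorem not_isLRepresentation_S4 (P : Fin 6 ⊕ Fin 4 → LPath) : ¬ IsLRepresentation S4 P := by
  intro hP
  rcases exists_covers (c := fun i => P (.inl i)) (share_splitGraph hP) with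
    ⟨x, m, hc⟩ | ⟨x, m, hc⟩
  · exact not_s4_of_covers hc (s := fun j => P (.inr j))
      fun i j => share_iff_of_rep hP (by simp)
  · exact not_s4_of_covers hc (s := fun j => (P (.inr j)).swap)
      fun i j => (share_swap _ _).trans (share_iff_of_rep hP (by simp))

theorem IsLRepresentation.comp {V W : Type*} {G : SimpleGraph V} {H : SimpleGraph W}
    {P : V → LPath} (hP : IsLRepresentation G P) (f : H ↪g G) :
    IsLRepresentation H (P ∘ f) := fun u v huv => by
  rw [← f.map_adj_iff]
  exact hP _ _ (f.injective.ne huv)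

theorem IsLRepresentation.not_isIndContained {V : Type*} {G : SimpleGraph V} {P : V → LPath}
    (hP : IsLRepresentation G P) : ¬ U1.IsIndContained G ∧ ¬ S4.IsIndContained G :=
  ⟨fun ⟨f⟩ => not_isLRepresentation_U1 _ (hP.comp f),
    fun ⟨f⟩ => not_isLRepresentation_S4 _ (hP.comp f)⟩

end EPG


namespace EPG

/-! ### Laminar families of neighbourhoods -/

section Laminar

variable {α β : Type*} {N : α → Set β}

/-- Members of the family that meet are comparable. -/
def Laminar (N : α → Set β) : Prop :=
  ∀ c c', (N c ∩ N c').Nonempty → N c ⊆ N c' ∨ N c' ⊆ N c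

/-- No member of the family includes three pairwise disjoint nonempty members. -/
def NoTriple (N : α → Set β) : Prop :=
  ∀ u a b c, N a ⊆ N u → N b ⊆ N u → N c ⊆ N u → (N a).Nonempty → (N b).Nonempty →
    (N c).Nonempty → Disjoint (N a) (N b) → Disjoint (N a) (N c) → Disjoint (N b) (N c) → False

/-- Two members each of which includes two disjoint nonempty members are not disjoint. -/
def NoTwoForks (N : α → Set β) : Prop :=
  ∀ u a a' v b b', N a ⊆ N u → N a' ⊆ N u → N b ⊆ N v → N b' ⊆ N v → (N a).Nonempty →
    (N a').Nonempty → (N b).Nonempty → (N b').Nonempty → Disjoint (N a) (N a') →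
    Disjoint (N b) (N b') → ¬ Disjoint (N u) (N v)

/-- The members `a` and `a'` are incomparable, and some member contains two points that show
this. -/
def Fork (N : α → Set β) (a a' : α) : Prop :=
  ∃ b s s', s ∈ N a ∧ s ∉ N a' ∧ s ∈ N b ∧ s' ∈ N a' ∧ s' ∉ N a ∧ s' ∈ N b

/-- The indices of the members that meet the member `a'` but not the member `a`. -/
def branch (N : α → Set β) (a a' : α) : Set α :=
  {c | (N c ∩ N a').Nonempty ∧ Disjoint (N c) (N a)}

/-- The union of the members that meet the member `a'` but not the member `a`. -/
def branchSet (N : α → Set β) (a a' : α) : Set β := ⋃ c ∈ branch N a a', N c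

theorem mem_branchSet {a a' : α} {s : β} :
    s ∈ branchSet N a a' ↔ ∃ c ∈ branch N a a', s ∈ N c := by
  simp [branchSet]

theorem Laminar.fork (hL : Laminar N) {a a' : α} (h : Fork N a a') :
    (N a).Nonempty ∧ (N a').Nonempty ∧ Disjoint (N a) (N a') ∧ ∃ b, N a ⊆ N b ∧ N a' ⊆ N b := by
  obtain ⟨b, s, s', h₁, h₂, h₃, h₄, h₅, h₆⟩ := h
  refine ⟨⟨s, h₁⟩, ⟨s', h₄⟩, ?_, b, ?_, ?_⟩
  · by_contra h
    rcases hL _ _ (Set.not_disjoint_iff_nonempty_inter.1 h) with h | h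
    · exact h₂ (h h₁)
    · exact h₅ (h h₄)
  · exact (hL a b ⟨s, h₁, h₃⟩).resolve_right fun h => h₅ (h h₆)
  · exact (hL a' b ⟨s', h₄, h₆⟩).resolve_right fun h => h₂ (h h₃)

/-- `N c` meets `N b` inside `N a'`, and it cannot include `N b` because it avoids the nonempty `N
a`. -/
theorem Laminar.branch_subset (hL : Laminar N) {a a' b c : α} (hne : (N a).Nonempty)
    (ha : N a ⊆ N b) (ha' : N a' ⊆ N b) (hc : c ∈ branch N a a') : N c ⊆ N b := by
  obtain ⟨⟨p, hp, hp'⟩, hd⟩ := hc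
  obtain ⟨s, hs⟩ := hne
  exact (hL c b ⟨p, hp, ha' hp'⟩).resolve_right
    fun h => Set.disjoint_left.1 hd (h (ha hs)) hs

/-- On the union of a branch the family is a chain. -/
theorem Laminar.chain_branchSet (hL : Laminar N) (hT : NoTriple N) {a a' : α}
    (h : Fork N a a') (c c' : α) :
    N c ∩ branchSet N a a' ⊆ N c' ∨ N c' ∩ branchSet N a a' ⊆ N c := by
  obtain ⟨hne, hne', hd, b, ha, ha'⟩ := hL.fork h
  -- A member that meets the union is comparable to some branch member. If it is included in one, it
  -- meets `N a'`, as otherwise `a`, `a'`, `c` would be a forbidden triple. If it includes one, it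
  -- either avoids `N a` or includes both `N a` and `N a'`, and then all of the branch.
  have key (c : α) : Disjoint (N c) (branchSet N a a') ∨ c ∈ branch N a a' ∨
      branchSet N a a' ⊆ N c := by
    by_cases h₀ : Disjoint (N c) (branchSet N a a')
    · exact .inl h₀
    refine .inr ?_
    obtain ⟨s, hs, hsB⟩ := Set.not_disjoint_iff.1 h₀
    obtain ⟨e, he, hse⟩ := mem_branchSet.1 hsB
    rcases hL c e ⟨s, hs, hse⟩ with hce | hec
    · left
      have hda := he.2.mono_left hce
      refine ⟨?_, hda⟩
      rw [← Set.not_disjoint_iff_nonempty_inter]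
      intro hda'
      exact hT b a a' c ha ha' (hce.trans (hL.branch_subset hne ha ha' he)) hne hne' ⟨s, hs⟩ hd
        hda.symm hda'.symm
    · obtain ⟨p, hp, hp'⟩ := he.1
      by_cases hda : Disjoint (N c) (N a)
      · exact .inl ⟨⟨p, hec hp, hp'⟩, hda⟩
      · right
        obtain ⟨t, ht, ht'⟩ := Set.not_disjoint_iff.1 hda
        have hac : N a ⊆ N c := (hL c a ⟨t, ht, ht'⟩).resolve_left
          fun h => Set.disjoint_left.1 hd (h (hec hp)) hp'
        have hac' : N a' ⊆ N c := (hL c a' ⟨p, hec hp, hp'⟩).resolve_left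
          fun h => Set.disjoint_left.1 hd ht' (h ht)
        exact Set.iUnion₂_subset fun f hf => hL.branch_subset hne hac hac' hf
  -- Disjoint branch members would form a forbidden triple with `N a`.
  have hK {c c' : α} (hc : c ∈ branch N a a') (hc' : c' ∈ branch N a a') :
      N c ⊆ N c' ∨ N c' ⊆ N c := by
    by_cases hm : Disjoint (N c) (N c')
    · exact (hT b a c c' ha (hL.branch_subset hne ha ha' hc) (hL.branch_subset hne ha ha' hc') hne
        (hc.1.mono Set.inter_subset_left) (hc'.1.mono Set.inter_subset_left) hc.2.symm hc'.2.symm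
        hm).elim
    · exact hL c c' (Set.not_disjoint_iff_nonempty_inter.1 hm)
  rcases key c with hc | hc | hc
  · exact .inl fun s hs => (Set.disjoint_left.1 hc hs.1 hs.2).elim
  · rcases key c' with hc' | hc' | hc'
    · exact .inr fun s hs => (Set.disjoint_left.1 hc' hs.1 hs.2).elim
    · exact (hK hc hc').imp (fun h s hs => h hs.1) fun h s hs => h hs.1
    · exact .inl fun s hs => hc' hs.2
  · exact .inr fun s hs => hc hs.2

/-- Outside of the union of a branch, the connected parts of the family are chains. -/
theorem Laminar.chain_compl_branchSet (hL : Laminar N) (hT : NoTriple N) (hF : NoTwoForks N)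
    {a a' : α} (h : Fork N a a') {c c' d : α} {s s' : β} (hs : s ∉ branchSet N a a')
    (hs' : s' ∉ branchSet N a a') (hsc : s ∈ N c) (hsd : s ∈ N d) (hsc' : s' ∈ N c')
    (hsd' : s' ∈ N d) : N c ⊆ N c' ∨ N c' ⊆ N c := by
  obtain ⟨hne, hne', hd, b, ha, ha'⟩ := hL.fork h
  by_cases hm : Disjoint (N c) (N c')
  · exfalso
    have hcd : N c ⊆ N d := (hL c d ⟨s, hsc, hsd⟩).resolve_right
      fun h => Set.disjoint_left.1 hm (h hsd') hsc'
    have hcd' : N c' ⊆ N d := (hL c' d ⟨s', hsc', hsd'⟩).resolve_right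
      fun h => Set.disjoint_left.1 hm hsc (h hsd)
    have hbd := Set.not_disjoint_iff_nonempty_inter.1
      (hF b a a' d c c' ha ha' hcd hcd' hne hne' ⟨s, hsc⟩ ⟨s', hsc'⟩ hd hm)
    -- The tops `b` and `d` of the two forks meet, so the larger one includes all four members.
    obtain ⟨u, hu, hu', hv, hv'⟩ : ∃ u, N a ⊆ N u ∧ N a' ⊆ N u ∧ N c ⊆ N u ∧ N c' ⊆ N u := by
      rcases hL b d hbd with h | h
      · exact ⟨d, ha.trans h, ha'.trans h, hcd, hcd'⟩
      · exact ⟨b, ha, ha', hcd.trans h, hcd'.trans h⟩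
    -- A member below `u` that avoids `N a` either avoids `N a'` too, giving a triple, or belongs to
    -- the branch.
    have meet {e : α} {t : β} (ht : t ∉ branchSet N a a') (hte : t ∈ N e) (heu : N e ⊆ N u) :
        (N e ∩ N a).Nonempty := by
      rw [← Set.not_disjoint_iff_nonempty_inter]
      intro hea
      refine hT u a a' e hu hu' heu hne hne' ⟨t, hte⟩ hd hea.symm ?_
      by_contra hea'
      rw [disjoint_comm, Set.not_disjoint_iff_nonempty_inter] at hea'
      exact ht (mem_branchSet.2 ⟨e, ⟨hea', hea⟩, hte⟩)
    obtain ⟨p, hp, hpa⟩ := meet hs hsc hv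
    obtain ⟨p', hp', hpa'⟩ := meet hs' hsc' hv'
    -- Both disjoint members meet `N a`, so neither includes it; lying inside `N a`, they form a
    -- triple with `N a'`.
    have hca : N c ⊆ N a := (hL c a ⟨p, hp, hpa⟩).resolve_right
      fun h => Set.disjoint_left.1 hm (h hpa') hp'
    have hca' : N c' ⊆ N a := (hL c' a ⟨p', hp', hpa'⟩).resolve_right
      fun h => Set.disjoint_left.1 hm hp (h hpa)
    exact hT u c c' a' hv hv' hu' ⟨s, hsc⟩ ⟨s', hsc'⟩ hne' hm (hd.mono_left hca)
      (hd.mono_left hca')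
  · exact hL c c' (Set.not_disjoint_iff_nonempty_inter.1 hm)

/-- Without forks, the connected parts of the family are chains. -/
theorem Laminar.chain_of_not_fork (hL : Laminar N) (h : ∀ a a', ¬ Fork N a a') {c c' d : α}
    {s s' : β} (hsc : s ∈ N c) (hsd : s ∈ N d) (hsc' : s' ∈ N c') (hsd' : s' ∈ N d) :
    N c ⊆ N c' ∨ N c' ⊆ N c := by
  by_cases hm : Disjoint (N c) (N c')
  · exact (h c c' ⟨d, s, s', hsc, fun h => Set.disjoint_left.1 hm hsc h, hsd, hsc',
      fun h => Set.disjoint_left.1 hm h hsc', hsd'⟩).elim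
  · exact hL c c' (Set.not_disjoint_iff_nonempty_inter.1 hm)

end Laminar

/-! ### Positions in a chain -/

section Rank

open Classical

variable {n : ℕ} (N : Fin n → Set (Fin n))

/-- The number of members of the family that contain `s`. -/
noncomputable def degree (s : Fin n) : ℕ := (Finset.univ.filter fun c => s ∈ N c).card

/-- The points in the order of decreasing degree. -/
def Prec (t s : Fin n) : Prop :=
  degree N s < degree N t ∨ degree N s = degree N t ∧ t < s

/-- The position of `s` among the points of `X`. -/
noncomputable def rank (X : Set (Fin n)) (s : Fin n) : ℕ :=
  (Finset.univ.filter fun t => t ∈ X ∧ Prec N t s).card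

variable {N} {X : Set (Fin n)}

theorem not_prec_self (s : Fin n) : ¬ Prec N s s := by
  simp [Prec]

/-- In a chain, the members are the initial segments. -/
theorem mem_iff_rank_lt (hX : ∀ c c', N c ∩ X ⊆ N c' ∨ N c' ∩ X ⊆ N c) {s : Fin n} (hs : s ∈ X)
    (c : Fin n) : s ∈ N c ↔ rank N X s < (Finset.univ.filter fun t => t ∈ N c ∧ t ∈ X).card := by
  -- By the chain condition every member that contains `t` contains `s`, and `N c` contains only
  -- `s`.
  have key {s t : Fin n} (hs : s ∈ X) (ht : t ∈ X) (hsc : s ∈ N c) (htc : t ∉ N c) :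
      degree N t < degree N s := by
    refine Finset.card_lt_card (Finset.ssubset_iff_of_subset ?_ |>.2 ⟨c, by simpa, by simpa⟩)
    intro c' hc'
    rw [Finset.mem_filter] at hc' ⊢
    refine ⟨Finset.mem_univ _, ?_⟩
    rcases hX c c' with h | h
    · exact h ⟨hsc, hs⟩
    · exact (htc (h ⟨hc'.2, ht⟩)).elim
  constructor
  · intro hsc
    refine Finset.card_lt_card (Finset.ssubset_iff_of_subset ?_ |>.2
      ⟨s, by simp [hsc, hs], by simp [not_prec_self]⟩)
    intro t ht
    simp only [Finset.mem_filter, Finset.mem_univ, true_and] at ht ⊢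
    refine ⟨?_, ht.1⟩
    by_contra htc
    have := key hs ht.1 hsc htc
    have := ht.2
    simp only [Prec] at this
    omega
  · intro h
    by_contra hsc
    refine h.not_ge (Finset.card_le_card fun t ht => ?_)
    simp only [Finset.mem_filter, Finset.mem_univ, true_and] at ht ⊢
    exact ⟨ht.2, .inl (key ht.2 hs ht.1 hsc)⟩

theorem rank_injOn : Set.InjOn (rank N X) X := by
  have key {s t : Fin n} (hs : s ∈ X) (h : Prec N s t) : rank N X s < rank N X t := by
    refine Finset.card_lt_card (Finset.ssubset_iff_of_subset ?_ |>.2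
      ⟨s, by simp [h, hs], by simp [not_prec_self]⟩)
    intro u hu
    simp only [Finset.mem_filter, Finset.mem_univ, true_and] at hu ⊢
    refine ⟨hu.1, ?_⟩
    have := hu.2
    simp only [Prec] at *
    omega
  intro s hs t ht h
  by_contra hne
  have : Prec N s t ∨ Prec N t s := by
    simp only [Prec]
    omega
  rcases this with hp | hp
  · exact (key hs hp).ne h
  · exact (key ht hp).ne h.symm

/-- The least element of a set of vertices, as a number. -/
noncomputable def least (Q : Set (Fin n)) : ℕ :=
  ∑ t : Fin n, if t ∈ Q ∧ ∀ u, u ∈ Q → ¬ u < t then (t : ℕ) else 0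

/-- At most one term of the sum is nonzero; in this form `PC.sum` computes a minimum. -/
theorem exists_mem_least_eq {Q : Set (Fin n)} (hQ : Q.Nonempty) : ∃ t ∈ Q, least Q = t := by
  obtain ⟨t, ht, hmin⟩ := WellFounded.has_min (wellFounded_lt (α := Fin n)) Q hQ
  refine ⟨t, ht, ?_⟩
  rw [least, Finset.sum_eq_single t, if_pos ⟨ht, hmin⟩]
  · intro u _ hut
    refine if_neg fun h => ?_
    rcases lt_or_gt_of_ne hut with h' | h'
    · exact hmin u h.1 h'
    · exact h.2 t ht h'
  · simp

end Rank

/-! ### Lexicographically minimal tuples -/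

/-- The tuple `x` is the lexicographically least one with the property `P`. -/
def IsLexMin {n k : ℕ} (P : (Fin k → Fin n) → Prop) (x : Fin k → Fin n) : Prop :=
  P x ∧ ∀ y, P y → ¬ ∃ i, (∀ j, j < i → y j = x j) ∧ y i < x i

/-- Uniqueness makes the choice of a fork or an obstruction definable, hence computable. -/
theorem existsUnique_isLexMin {n k : ℕ} {P : (Fin k → Fin n) → Prop} (h : ∃ x, P x) :
    ∃! x, IsLexMin P x := by
  obtain ⟨x, hx, hmin⟩ := (Set.toFinite {x : Lex (Fin k → Fin n) | P (ofLex x)}).exists_minimal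
    (h.imp fun _ h => h)
  have hmin' : ∀ y : Lex (Fin k → Fin n), P (ofLex y) → ¬ y < x :=
    fun y hy hlt => hlt.not_ge (hmin hy hlt.le)
  refine ⟨ofLex x, ⟨hx, fun y hy hlt => hmin' (toLex y) hy hlt⟩, fun y hy => ?_⟩
  rcases lt_trichotomy (toLex y) x with h | h | h
  · exact (hmin' _ hy.1 h).elim
  · exact h
  · exact (hy.2 _ hx h).elim

/-! ### The representation -/

namespace Inst

open Classical

variable (I : Inst)

/-- The neighbourhood in the stable set of a vertex of the clique, and `∅` for other vertices. -/
def nb (c : Fin I.n) : Set (Fin I.n) := {s | c ∈ I.C ∧ s ∉ I.C ∧ I.G.Adj c s}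

/-- A union of a branch, if there is a fork; the corresponding paths are placed in the column that
contains the common edge of all paths of the clique. -/
def col : Set (Fin I.n) :=
  {s | ∃ x : Fin 2 → Fin I.n, IsLexMin (fun x => Fork I.nb (x 0) (x 1)) x ∧
    s ∈ branchSet I.nb (x 0) (x 1)}

/-- The stable vertices whose paths are placed in the same line as the path of `s`. -/
def line (s : Fin I.n) : Set (Fin I.n) :=
  {t | s ∈ I.col ∧ t ∈ I.col ∨ s ∉ I.col ∧ t ∉ I.col ∧ (s = t ∨ ∃ c, s ∈ I.nb c ∧ t ∈ I.nb c)}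

/-- The row of the path of a clique vertex. -/
noncomputable def row (c : Fin I.n) : ℕ :=
  if ∃ s, s ∈ I.nb c ∧ s ∉ I.col then least {t | ∃ s, (s ∈ I.nb c ∧ s ∉ I.col) ∧ t ∈ I.line s}
  else I.n

/-- The abscissa of the bend point. -/
noncomputable def outX (v : Fin I.n) : ℕ :=
  if v ∈ I.C then 0 else if v ∈ I.col then 0 else 1 + rank I.nb (I.line v) v

/-- The ordinate of the bend point. -/
noncomputable def outY (v : Fin I.n) : ℕ :=
  if v ∈ I.C then I.row v
  else if v ∈ I.col then I.n + 1 + rank I.nb (I.line v) v else least (I.line v)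

/-- The length of the vertical arm. -/
noncomputable def outUp (v : Fin I.n) : ℕ :=
  if v ∈ I.C then
    I.n + 1 - I.row v + (Finset.univ.filter fun t => t ∈ I.nb v ∧ t ∈ I.col).card
  else 1

/-- The length of the horizontal arm. -/
noncomputable def outRight (v : Fin I.n) : ℕ :=
  if v ∈ I.C then 1 + (Finset.univ.filter fun t => t ∈ I.nb v ∧ t ∉ I.col).card else 1

/-! ### Correctness of the drawing -/

variable {I}

/-- Hence every clique path contains the edge from (0, n) to (0, n+1). The default row `n` holds no
stable path: rows of lines are smaller and those of the column are larger. -/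
theorem row_le (c : Fin I.n) : I.row c ≤ I.n := by
  unfold row
  split_ifs with h
  · obtain ⟨s, hs⟩ := h
    obtain ⟨t, -, ht⟩ := exists_mem_least_eq
      (Q := {t | ∃ s, (s ∈ I.nb c ∧ s ∉ I.col) ∧ t ∈ I.line s})
      ⟨s, s, hs, .inr ⟨hs.2, hs.2, .inl rfl⟩⟩
    rw [ht]
    exact t.2.le
  · exact le_rfl

theorem outUp_pos (v : Fin I.n) : 0 < I.outUp v := by
  unfold outUp
  split_ifs
  · have := I.row_le v
    omega
  · exact one_pos

theorem outRight_pos (v : Fin I.n) : 0 < I.outRight v := by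
  unfold outRight
  split_ifs <;> omega

/-- The path of the vertex `v`. -/
noncomputable def path (v : Fin I.n) : LPath :=
  ⟨(I.outX v, I.outY v), I.outUp v, I.outRight v, .inl (I.outUp_pos v)⟩

theorem mem_line_self (s : Fin I.n) : s ∈ I.line s := by
  by_cases h : s ∈ I.col
  · exact .inl ⟨h, h⟩
  · exact .inr ⟨h, h, .inl rfl⟩

/-- The family of neighbourhoods is a chain on the column and on every connected part of its
complement. -/
structure Chains (I : Inst) : Prop where
  col : ∀ c c', I.nb c ∩ I.col ⊆ I.nb c' ∨ I.nb c' ∩ I.col ⊆ I.nb c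
  rows : ∀ c c' d s s', s ∉ I.col → s' ∉ I.col → s ∈ I.nb c → s ∈ I.nb d → s' ∈ I.nb c' →
    s' ∈ I.nb d → I.nb c ⊆ I.nb c' ∨ I.nb c' ⊆ I.nb c

theorem chains_of_laminar (hL : Laminar I.nb) (hT : NoTriple I.nb) (hF : NoTwoForks I.nb) :
    I.Chains := by
  by_cases h : ∃ x : Fin 2 → Fin I.n, Fork I.nb (x 0) (x 1)
  · obtain ⟨x, hx, huniq⟩ := existsUnique_isLexMin h
    have hcol : I.col = branchSet I.nb (x 0) (x 1) := by
      ext s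
      exact ⟨fun ⟨y, hy, hs⟩ => huniq y hy ▸ hs, fun hs => ⟨x, hx, hs⟩⟩
    constructor
    · rw [hcol]
      exact hL.chain_branchSet hT hx.1
    · rw [hcol]
      intro c c' d s s'
      exact hL.chain_compl_branchSet hT hF hx.1
  · have hcol (s : Fin I.n) : s ∉ I.col := fun ⟨x, hx, _⟩ => h ⟨x, hx.1⟩
    have hf (a a' : Fin I.n) : ¬ Fork I.nb a a' := fun hf => h ⟨![a, a'], by simpa using hf⟩
    exact ⟨fun c c' => .inl fun s hs => (hcol s hs.2).elim,
      fun c c' d s s' _ _ => hL.chain_of_not_fork hf⟩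

/-- Lying in one line is an equivalence relation: for transitivity, two members through a common
point off the column are comparable, and the larger contains all three points. -/
theorem Chains.line_eq (hI : I.Chains) {s t : Fin I.n} (h : t ∈ I.line s) :
    I.line s = I.line t := by
  have symm {s t : Fin I.n} (h : t ∈ I.line s) : s ∈ I.line t := by
    rcases h with ⟨hs, ht⟩ | ⟨hs, ht, rfl | ⟨c, hc⟩⟩
    · exact .inl ⟨ht, hs⟩
    · exact .inr ⟨hs, hs, .inl rfl⟩
    · exact .inr ⟨ht, hs, .inr ⟨c, hc.symm⟩⟩
  have trans {s t u : Fin I.n} (h : t ∈ I.line s) (h' : u ∈ I.line t) : u ∈ I.line s := by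
    rcases h with ⟨hs, ht⟩ | ⟨hs, ht, rfl | ⟨c, hc⟩⟩
    · rcases h' with ⟨_, hu⟩ | ⟨ht', _⟩
      · exact .inl ⟨hs, hu⟩
      · exact (ht' ht).elim
    · exact h'
    · rcases h' with ⟨ht', _⟩ | ⟨_, hu, rfl | ⟨d, hd⟩⟩
      · exact (ht ht').elim
      · exact .inr ⟨hs, ht, .inr ⟨c, hc⟩⟩
      · refine .inr ⟨hs, hu, .inr ?_⟩
        rcases hI.rows c d d t t ht ht hc.2 hd.1 hd.1 hd.1 with h | h
        · exact ⟨d, h hc.1, hd.2⟩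
        · exact ⟨c, hc.1, h hd.2⟩
  ext u
  exact ⟨trans (symm h), trans h⟩

theorem Chains.line_chain (hI : I.Chains) (s c c' : Fin I.n) :
    I.nb c ∩ I.line s ⊆ I.nb c' ∨ I.nb c' ∩ I.line s ⊆ I.nb c := by
  by_cases hs : s ∈ I.col
  · have h : I.line s ⊆ I.col := fun t ht => ht.elim (·.2) fun h => (h.1 hs).elim
    exact (hI.col c c').imp (fun h' t ht => h' ⟨ht.1, h ht.2⟩) fun h' t ht => h' ⟨ht.1, h ht.2⟩
  · by_contra! hcon
    obtain ⟨⟨t, ⟨htc, hts⟩, htc'⟩, hcon'⟩ := hcon.imp Set.not_subset.1 Set.not_subset.1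
    obtain ⟨t', ⟨htc₁, hts'⟩, htc₁'⟩ := hcon'
    have htt : t' ∈ I.line t := hI.line_eq hts ▸ hts'
    rcases htt with ⟨ht, _⟩ | ⟨ht, ht', rfl | ⟨d, hd⟩⟩
    · rcases hts with ⟨hs', _⟩ | ⟨_, ht', _⟩
      · exact hs hs'
      · exact ht' ht
    · exact htc' htc₁
    · rcases hI.rows c c' d t t' ht ht' htc hd.1 htc₁ hd.2 with h | h
      · exact htc' (h htc)
      · exact htc₁' (h htc₁)

theorem Chains.least_line_inj (hI : I.Chains) {s t : Fin I.n}
    (h : least (I.line s) = least (I.line t)) : t ∈ I.line s := by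
  obtain ⟨u, hu, hu'⟩ := exists_mem_least_eq ⟨s, I.mem_line_self s⟩
  obtain ⟨w, hw, hw'⟩ := exists_mem_least_eq ⟨t, I.mem_line_self t⟩
  obtain rfl : u = w := Fin.ext (by omega)
  rw [hI.line_eq hu, ← hI.line_eq hw]
  exact I.mem_line_self t

theorem least_line_lt (s : Fin I.n) : least (I.line s) < I.n := by
  obtain ⟨u, hu, hu'⟩ := exists_mem_least_eq ⟨s, I.mem_line_self s⟩
  exact hu' ▸ u.2

theorem mem_line_of_mem_nb {c s t : Fin I.n} (hs : s ∈ I.nb c) (ht : t ∈ I.nb c)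
    (hs' : s ∉ I.col) (ht' : t ∉ I.col) : t ∈ I.line s :=
  .inr ⟨hs', ht', .inr ⟨c, hs, ht⟩⟩

/-- The neighbours of `c` off the column share `c`, so they all lie in one line. -/
theorem Chains.row_eq (hI : I.Chains) {c s : Fin I.n} (hs : s ∈ I.nb c) (hs' : s ∉ I.col) :
    I.row c = least (I.line s) := by
  rw [row, if_pos ⟨s, hs, hs'⟩]
  congr 1
  ext t
  constructor
  · rintro ⟨s', h, ht⟩
    rwa [hI.line_eq (mem_line_of_mem_nb hs h.1 hs' h.2)]
  · exact fun ht => ⟨s, ⟨hs, hs'⟩, ht⟩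

/-- In the column, `s` starts at height `n + 1 + rank` and the arm of `c` ends at `n + 1` plus its
number of neighbours there. In a row, the corresponding abscissas have offset 1. Both times sharing
an edge compares the rank with the size of an initial segment. -/
theorem Chains.share_iff (hI : I.Chains) {c s : Fin I.n} (hc : c ∈ I.C) (hs : s ∉ I.C) :
    Share (I.path c) (I.path s) ↔ s ∈ I.nb c := by
  have hrow := I.row_le c
  rw [mem_iff_rank_lt (hI.line_chain s) (I.mem_line_self s) c]
  by_cases hcol : s ∈ I.col
  · have hl : I.line s = I.col := by
      ext t
      exact ⟨fun ht => ht.elim (·.2) fun h => (h.1 hcol).elim, fun ht => .inl ⟨hcol, ht⟩⟩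
    simp only [Share, VShare, HShare, path, outX, outY, outUp, outRight, if_pos hc, if_neg hs,
      if_pos hcol, true_and]
    simp only [hl]
    omega
  · have hlt := I.least_line_lt s
    -- The row is below `n`, so it is not the default one, and the line of `s` contains all
    -- neighbours of `c` off the column.
    have hcard (h : I.row c = least (I.line s)) :
        (Finset.univ.filter fun t => t ∈ I.nb c ∧ t ∈ I.line s) =
          Finset.univ.filter fun t => t ∈ I.nb c ∧ t ∉ I.col := by
      have hex : ∃ s', s' ∈ I.nb c ∧ s' ∉ I.col := by
        by_contra hno
        rw [row, if_neg hno] at h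
        omega
      obtain ⟨s', h₁, h₂⟩ := hex
      rw [hI.row_eq h₁ h₂] at h
      have hs' := hI.line_eq (hI.least_line_inj h)
      ext t
      simp only [Finset.mem_filter, Finset.mem_univ, true_and]
      refine and_congr_right fun ht => ⟨fun htl => ?_, fun htc => ?_⟩
      · exact htl.elim (fun h => (hcol h.1).elim) (·.2.1)
      · exact hs' ▸ mem_line_of_mem_nb h₁ ht h₂ htc
    have hmem (h : rank I.nb (I.line s) s <
        (Finset.univ.filter fun t => t ∈ I.nb c ∧ t ∈ I.line s).card) :
        I.row c = least (I.line s) :=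
      hI.row_eq ((mem_iff_rank_lt (hI.line_chain s) (I.mem_line_self s) c).2 h) hcol
    simp only [Share, VShare, HShare, path, outX, outY, outUp, outRight, if_pos hc, if_neg hs,
      if_neg hcol]
    constructor
    · intro h
      have hr : I.row c = least (I.line s) := by omega
      rw [hcard hr]
      omega
    · intro h
      have hr := hmem h
      rw [hcard hr] at h
      omega

/-- Stable paths have unit arms, so they share an edge only if their bend points coincide. -/
theorem Chains.not_share (hI : I.Chains) {s t : Fin I.n} (hs : s ∉ I.C) (ht : t ∉ I.C)
    (hst : s ≠ t) : ¬ Share (I.path s) (I.path t) := by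
  have hinj (h : t ∈ I.line s) : rank I.nb (I.line s) s ≠ rank I.nb (I.line t) t := by
    rw [← hI.line_eq h]
    exact fun h' => hst (rank_injOn (I.mem_line_self s) h h')
  simp only [Share, VShare, HShare, path, outX, outY, outUp, outRight, if_neg ht, if_neg hs]
  by_cases hs' : s ∈ I.col <;> by_cases ht' : t ∈ I.col <;>
    simp only [hs', ht', if_true, if_false]
  · have := hinj (.inl ⟨hs', ht'⟩)
    omega
  · omega
  · omega
  · by_cases h : least (I.line s) = least (I.line t)
    · have := hinj (hI.least_line_inj h)
      omega
    · omega

theorem share_of_mem {c c' : Fin I.n} (hc : c ∈ I.C) (hc' : c' ∈ I.C) :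
    Share (I.path c) (I.path c') := by
  have h₁ := I.row_le c
  have h₂ := I.row_le c'
  left
  simp only [VShare, path, outX, outY, outUp, if_pos hc, if_pos hc', true_and]
  omega

theorem share_comm (P Q : LPath) : Share P Q ↔ Share Q P := by
  simp only [Share, VShare, HShare]
  omega

theorem Chains.isLRepresentation (hI : I.Chains) (hS : IsSplitPartition I.G I.C I.Cᶜ) :
    IsLRepresentation I.G I.path := by
  obtain ⟨-, hC, hS⟩ := hS
  intro u v huv
  rw [edges_inter_nonempty_iff]
  by_cases hu : u ∈ I.C <;> by_cases hv : v ∈ I.C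
  · exact iff_of_true (hC hu hv huv) (share_of_mem hu hv)
  · rw [hI.share_iff hu hv]
    exact ⟨fun h => ⟨hu, hv, h⟩, fun h => h.2.2⟩
  · rw [share_comm, hI.share_iff hv hu, I.G.adj_comm]
    exact ⟨fun h => ⟨hv, hu, h⟩, fun h => h.2.2⟩
  · exact iff_of_false (hS hu hv huv) (hI.not_share hu hv huv)

end Inst

end EPG


namespace EPG

open Ctx

/-! ### The representation is computable in polynomial time -/

section

variable {Γ : Type} [Ctx Γ] {u v w : (γ : Γ) → Fin (inst γ).n}

theorem PCV.nb (hu : PCV u) (hv : PCV v) : PCP (fun γ => v γ ∈ (inst γ).nb (u γ)) :=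
  hu.mem.and (hv.mem.not.and (hu.adj hv))

theorem PCV.fork (hu : PCV u) (hv : PCV v) : PCP (fun γ => Fork (inst γ).nb (u γ) (v γ)) :=
  .exists <| .exists <| .exists <|
    (hu.fst.fst.fst.nb PCV.snd.fst).and <| (hv.fst.fst.fst.nb PCV.snd.fst).not.and <|
    (PCV.snd.fst.fst.nb PCV.snd.fst).and <| (hv.fst.fst.fst.nb PCV.snd).and <|
    (hu.fst.fst.fst.nb PCV.snd).not.and (PCV.snd.fst.fst.nb PCV.snd)

theorem PCV.branchSet (hu : PCV u) (hv : PCV v) (hw : PCV w) :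
    PCP (fun γ => w γ ∈ branchSet (inst γ).nb (u γ) (v γ)) := by
  refine PCP.congr (P := fun γ => ∃ c, ((∃ t, t ∈ (inst γ).nb c ∧ t ∈ (inst γ).nb (v γ)) ∧
    ∀ t, t ∈ (inst γ).nb c → ¬ t ∈ (inst γ).nb (u γ)) ∧ w γ ∈ (inst γ).nb c) ?_ fun γ => ?_
  · exact .exists <| .and (.and (.exists <| (PCV.snd.fst.nb PCV.snd).and (hv.fst.fst.nb PCV.snd))
      (.forall <| (PCV.snd.fst.nb PCV.snd).imp (hu.fst.fst.nb PCV.snd).not))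
      (PCV.snd.nb hw.fst)
  · simp only [mem_branchSet, branch, Set.disjoint_left]
    rfl

end

/-- The property `P` of tuples of vertices is decidable in polynomial time. -/
def PCTuple {k : ℕ} (P : (I : Inst) → (Fin k → Fin I.n) → Prop) : Prop :=
  ∀ (Γ : Type) [Ctx Γ], PCP (fun p : (γ : Γ) × (Fin k → Fin (inst γ).n) => P (inst p.1) p.2)

theorem PCTuple.isLexMin {k : ℕ} {P : (I : Inst) → (Fin k → Fin I.n) → Prop} (hP : PCTuple P) :
    PCTuple (fun I => IsLexMin (P I)) := by
  intro Γ _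
  refine (hP Γ).and (.forallTuple ((hP _).imp (PCP.not ?_)))
  exact .exists_fin fun i => .and
    (.forall_fin fun j => (PCP.const (j < i)).imp ((PCV.coord j).eq (PCV.coord j).fstTuple))
    ((PCV.coord i).lt (PCV.coord i).fstTuple)

open Classical in
/-- The entry number `v` of the least tuple with the property `P`. -/
noncomputable def witness {n k : ℕ} (P : (Fin k → Fin n) → Prop) (v : ℕ) : ℕ :=
  ∑ x : Fin k → Fin n, if IsLexMin P x then ∑ i : Fin k, if v = i then (x i : ℕ) else 0 else 0

theorem exists_witness_eq {n k : ℕ} {P : (Fin k → Fin n) → Prop} (h : ∃ x, P x) :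
    ∃ x, P x ∧ ∀ i : Fin k, witness P i = x i := by
  obtain ⟨x, hx, huniq⟩ := existsUnique_isLexMin h
  refine ⟨x, hx.1, fun i => ?_⟩
  rw [witness, Finset.sum_eq_single x, if_pos hx, Finset.sum_eq_single i, if_pos rfl]
  · exact fun j _ hj => if_neg fun h => hj (Fin.ext h.symm)
  · simp
  · exact fun y _ hy => if_neg fun h => hy (huniq y h)
  · simp

section

variable {Γ : Type} [Ctx Γ] {u v w : (γ : Γ) → Fin (inst γ).n}

theorem PCTuple.witness {k : ℕ} {P : (I : Inst) → (Fin k → Fin I.n) → Prop} (hP : PCTuple P)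
    {f : Γ → ℕ} (hf : PC f) : PC (fun γ => witness (P (inst γ)) (f γ)) :=
  .sumTuple <| .ite (hP.isLexMin Γ)
    (.sum_fin fun i => .ite (.eq (.fstTuple hf) (.const i)) (PCV.coord i) (.const 0)) (.const 0)

theorem PCV.col (hv : PCV v) : PCP (fun γ => v γ ∈ (inst γ).col) :=
  .existsTuple <| .and
    (PCTuple.isLexMin (P := fun I x => Fork I.nb (x 0) (x 1))
      (fun _ _ => (PCV.coord 0).fork (PCV.coord 1)) Γ)
    ((PCV.coord 0).branchSet (PCV.coord 1) hv.fstTuple)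

theorem PCV.line (hu : PCV u) (hv : PCV v) : PCP (fun γ => v γ ∈ (inst γ).line (u γ)) :=
  .or (hu.col.and hv.col) <| hu.col.not.and <| hv.col.not.and <| .or (hu.eq hv) <| .exists <|
    (PCV.snd.nb hu.fst).and (PCV.snd.nb hv.fst)

theorem PCV.degree (hv : PCV v) : PC (fun γ => degree (inst γ).nb (v γ)) :=
  .card (PCV.snd.nb hv.fst)

theorem PCV.rank (hv : PCV v) :
    PC (fun γ => rank (inst γ).nb ((inst γ).line (v γ)) (v γ)) :=
  .card <| (hv.fst.line PCV.snd).and <| .or (.lt hv.fst.degree PCV.snd.degree) <|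
    .and (.eq hv.fst.degree PCV.snd.degree) (PCV.snd.lt hv.fst)

/-- Membership in `Q` is queried below one and below two bound vertices, whence the two hypotheses.
-/
theorem PC.least {Q : (γ : Γ) → Set (Fin (inst γ).n)}
    (h : PCP (fun p : (γ : Γ) × Fin (inst γ).n => p.2 ∈ Q p.1))
    (h' : PCP (fun p : (p : (γ : Γ) × Fin (inst γ).n) × Fin (inst p).n => p.2 ∈ Q p.1.1)) :
    PC (fun γ => least (Q γ)) :=
  .sum <| .ite (h.and <| .forall <| h'.imp (PCV.snd.lt PCV.snd.fst).not) PCV.snd (.const 0)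

theorem PCV.leastLine (hv : PCV v) : PC (fun γ => EPG.least ((inst γ).line (v γ))) :=
  .least (hv.fst.line .snd) (hv.fst.fst.line .snd)

theorem PCV.row (hv : PCV v) : PC (fun γ => (inst γ).row (v γ)) :=
  .ite (.exists <| (hv.fst.nb .snd).and (PCV.col .snd).not)
    (.least
      (.exists <| .and ((hv.fst.fst.nb .snd).and (PCV.col .snd).not) (PCV.snd.line PCV.snd.fst))
      (.exists <| .and ((hv.fst.fst.fst.nb .snd).and (PCV.col .snd).not)
        (PCV.snd.line PCV.snd.fst)))
    .size

theorem PCV.outX (hv : PCV v) : PC (fun γ => (inst γ).outX (v γ)) :=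
  .ite hv.mem (.const 0) (.ite hv.col (.const 0) (.add (.const 1) hv.rank))

theorem PCV.outY (hv : PCV v) : PC (fun γ => (inst γ).outY (v γ)) :=
  .ite hv.mem hv.row (.ite hv.col (.add (.add .size (.const 1)) hv.rank) hv.leastLine)

theorem PCV.outUp (hv : PCV v) : PC (fun γ => (inst γ).outUp (v γ)) :=
  .ite hv.mem (.add (.sub (.add .size (.const 1)) hv.row)
    (.card ((hv.fst.nb .snd).and (PCV.col .snd)))) (.const 1)

theorem PCV.outRight (hv : PCV v) : PC (fun γ => (inst γ).outRight (v γ)) :=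
  .ite hv.mem (.add (.const 1) (.card ((hv.fst.nb .snd).and (PCV.col .snd).not))) (.const 1)

end

end EPG


namespace EPG

/-! ### Induced copies of the obstructions -/

instance {c s : ℕ} (N : Fin s → Finset (Fin c)) : DecidableRel (splitGraph c s N).Adj
  | .inl i, .inl j => inferInstanceAs (Decidable (i ≠ j))
  | .inl i, .inr j => inferInstanceAs (Decidable (i ∈ N j))
  | .inr j, .inl i => inferInstanceAs (Decidable (i ∈ N j))
  | .inr _, .inr _ => inferInstanceAs (Decidable False)

/-- The pattern of adjacencies between the two sides determines an induced copy of a split graph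
in which vertices have distinct neighbourhoods. -/
theorem exists_splitGraph_embedding {V : Type*} {G : SimpleGraph V} {C : Set V} {c s : ℕ}
    {N : Fin s → Finset (Fin c)} (hG : IsSplitPartition G C Cᶜ)
    (hN : ∀ i j, (∀ k, i ∈ N k ↔ j ∈ N k) → i = j) (hN' : ∀ k l, N k = N l → k = l)
    {x : Fin c → V} {y : Fin s → V} (hx : ∀ i, x i ∈ C) (hy : ∀ k, y k ∉ C)
    (h : ∀ i k, G.Adj (x i) (y k) ↔ i ∈ N k) :
    ∃ f : splitGraph c s N ↪g G, (∀ i, f (.inl i) = x i) ∧ ∀ k, f (.inr k) = y k := by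
  have hxinj : Function.Injective x := fun i j hij => hN i j fun k => by rw [← h, ← h, hij]
  have hyinj : Function.Injective y := fun k l hkl => hN' k l <| by
    ext i
    rw [← h, ← h, hkl]
  refine ⟨⟨⟨Sum.elim x y, hxinj.sumElim hyinj fun i k hik => hy k (hik ▸ hx i)⟩, ?_⟩,
    fun _ => rfl, fun _ => rfl⟩
  rintro (i | k) (j | l)
  · exact ⟨fun hij => fun e => G.ne_of_adj hij (congrArg x e),
      fun hij => hG.2.1 (hx i) (hx j) (hxinj.ne hij)⟩
  · exact h i l
  · exact (G.adj_comm _ _).trans (h j k)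
  · refine ⟨fun hkl => ?_, fun hkl => hkl.elim⟩
    exact hG.2.2 (hy k) (hy l) (G.ne_of_adj hkl) hkl

/-! ### Excluded subgraphs as conditions on the neighbourhoods -/

namespace Inst

variable {I : Inst}

theorem mem_nb_iff {c s : Fin I.n} (hc : c ∈ I.C) (hs : s ∉ I.C) :
    I.G.Adj c s ↔ s ∈ I.nb c := ⟨fun h => ⟨hc, hs, h⟩, fun h => h.2.2⟩

/-- Points `a`, `d` that witness incomparability and a common point `e` form a bull with the clique
vertices `b`, `c`. -/
theorem laminar_of_not_hasSBull (hG : IsSplitPartition I.G I.C I.Cᶜ)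
    (h : ¬ HasSBull I.G I.Cᶜ) : Laminar I.nb := by
  rintro b c ⟨e, heb, hec⟩
  by_contra! hcon
  obtain ⟨hcon₁, hcon₂⟩ := hcon
  obtain ⟨a, hab, hac⟩ := Set.not_subset.1 hcon₁
  obtain ⟨d, hdc, hdb⟩ := Set.not_subset.1 hcon₂
  obtain ⟨f, hf₁, hf₂⟩ := exists_splitGraph_embedding (N := ![{0}, {1}, {0, 1}]) hG
    (by decide) (by decide) (x := ![b, c]) (y := ![a, d, e])
    (by simp [Fin.forall_fin_succ, heb.1, hec.1])
    (by simp [Fin.forall_fin_succ, hab.2.1, hdc.2.1, hec.2.1])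
    (by
      simp [Fin.forall_fin_succ, mem_nb_iff heb.1 hab.2.1, mem_nb_iff heb.1 hdc.2.1,
        mem_nb_iff heb.1 hec.2.1, mem_nb_iff hec.1 hab.2.1, mem_nb_iff hec.1 hdc.2.1,
        mem_nb_iff hec.1 hec.2.1, *])
  let g : Fin 5 → Fin 2 ⊕ Fin 3 := ![.inr 0, .inl 0, .inl 1, .inr 1, .inr 2]
  have hg : Function.Injective g := by decide
  refine h ⟨⟨⟨f ∘ g, f.injective.comp hg⟩, ?_⟩, ?_⟩
  · have key (i j : Fin 5) :
        (splitGraph 2 3 ![{0}, {1}, {0, 1}]).Adj (g i) (g j) ↔ bull.Adj i j := by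
      simp only [bull, SimpleGraph.fromEdgeSet_adj, Set.mem_insert_iff, Set.mem_singleton_iff]
      revert i j
      decide
    exact fun {i j} => f.map_adj_iff.trans (key i j)
  · intro v hv
    -- The clique vertices 1 and 2 have degree three, so they need not lie in the stable set.
    have h₁ : 3 ≤ (bull.neighborSet 1).ncard := by
      have : (({0, 2, 4} : Finset (Fin 5)) : Set (Fin 5)) ⊆ bull.neighborSet 1 := by
        intro i hi
        simp only [bull, SimpleGraph.mem_neighborSet, SimpleGraph.fromEdgeSet_adj,
          Set.mem_insert_iff, Set.mem_singleton_iff]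
        rw [Finset.mem_coe] at hi
        revert i
        decide
      simpa using Set.ncard_le_ncard this
    have h₂ : 3 ≤ (bull.neighborSet 2).ncard := by
      have : (({1, 3, 4} : Finset (Fin 5)) : Set (Fin 5)) ⊆ bull.neighborSet 2 := by
        intro i hi
        simp only [bull, SimpleGraph.mem_neighborSet, SimpleGraph.fromEdgeSet_adj,
          Set.mem_insert_iff, Set.mem_singleton_iff]
        rw [Finset.mem_coe] at hi
        revert i
        decide
      simpa using Set.ncard_le_ncard this
    fin_cases v
    · exact (hf₂ 0).symm ▸ hab.2.1
    · exact absurd hv h₁.not_gt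
    · exact absurd hv h₂.not_gt
    · exact (hf₂ 1).symm ▸ hdc.2.1
    · exact (hf₂ 2).symm ▸ hec.2.1

theorem noTriple_of_not_isIndContained (hG : IsSplitPartition I.G I.C I.Cᶜ)
    (h : ¬ U1.IsIndContained I.G) : NoTriple I.nb := by
  rintro u a b c hau hbu hcu ⟨s, hs⟩ ⟨t, ht⟩ ⟨r, hr⟩ hab hac hbc
  have hu := (hau hs).1
  have h₁ := Set.disjoint_left.1 hab hs
  have h₂ := Set.disjoint_left.1 hac hs
  have h₃ := Set.disjoint_right.1 hab ht
  have h₄ := Set.disjoint_left.1 hbc ht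
  have h₅ := Set.disjoint_right.1 hac hr
  have h₆ := Set.disjoint_right.1 hbc hr
  obtain ⟨f, -⟩ := exists_splitGraph_embedding (N := ![{0, 1}, {0, 2}, {0, 3}]) hG
    (by decide) (by decide) (x := ![u, a, b, c]) (y := ![s, t, r])
    (by simp [Fin.forall_fin_succ, hu, hs.1, ht.1, hr.1])
    (by simp [Fin.forall_fin_succ, hs.2.1, ht.2.1, hr.2.1])
    (by
      have key {d e : Fin I.n} (hd : d ∈ I.C) (he : e ∉ I.C) := mem_nb_iff hd he
      simp [Fin.forall_fin_succ, hs.1, ht.1, hr.1, hs.2.1, ht.2.1, hr.2.1, hau hs,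
        hbu ht, hcu hr, *])
  exact h ⟨f⟩

/-- The gems are centred at `u` and `v`; disjointness of `N u` and `N v` excludes edges from the
clique of one to the stable vertices of the other. -/
theorem noTwoForks_of_not_isIndContained (hG : IsSplitPartition I.G I.C I.Cᶜ)
    (h : ¬ S4.IsIndContained I.G) : NoTwoForks I.nb := by
  rintro u a a' v b b' hau hau' hbv hbv' ⟨s, hs⟩ ⟨s', hs'⟩ ⟨t, ht⟩ ⟨t', ht'⟩ ha hb huv
  have hu := (hau hs).1
  have hv := (hbv ht).1
  have h₁ := Set.disjoint_left.1 ha hs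
  have h₂ := Set.disjoint_right.1 ha hs'
  have h₃ := Set.disjoint_left.1 hb ht
  have h₄ := Set.disjoint_right.1 hb ht'
  have hU {p : Fin I.n} (hp : p ∈ I.nb u) : p ∉ I.nb v ∧ p ∉ I.nb b ∧ p ∉ I.nb b' :=
    have := Set.disjoint_left.1 huv hp
    ⟨this, fun h => this (hbv h), fun h => this (hbv' h)⟩
  have hV {p : Fin I.n} (hp : p ∈ I.nb v) : p ∉ I.nb u ∧ p ∉ I.nb a ∧ p ∉ I.nb a' :=
    have := Set.disjoint_right.1 huv hp
    ⟨this, fun h => this (hau h), fun h => this (hau' h)⟩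
  obtain ⟨f, -⟩ := exists_splitGraph_embedding (N := ![{0, 1}, {1, 2}, {3, 4}, {4, 5}]) hG
    (by decide) (by decide) (x := ![a, u, a', b, v, b']) (y := ![s, s', t, t'])
    (by simp [Fin.forall_fin_succ, hu, hv, hs.1, hs'.1, ht.1, ht'.1])
    (by simp [Fin.forall_fin_succ, hs.2.1, hs'.2.1, ht.2.1, ht'.2.1])
    (by
      have key {d e : Fin I.n} (hd : d ∈ I.C) (he : e ∉ I.C) := mem_nb_iff hd he
      simp [Fin.forall_fin_succ, key, hu, hv, hs.1, hs'.1, ht.1, ht'.1, hs.2.1, hs'.2.1, ht.2.1,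
        ht'.2.1, hau hs, hau' hs', hbv ht, hbv' ht', hU (hau hs), hU (hau' hs'), hV (hbv ht),
        hV (hbv' ht'), hs, hs', ht, ht', h₁, h₂, h₃, h₄])
  exact h ⟨f⟩

theorem isLRepresentation_path (hG : IsSplitPartition I.G I.C I.Cᶜ) (hB : ¬ HasSBull I.G I.Cᶜ)
    (hU : ¬ U1.IsIndContained I.G) (hS : ¬ S4.IsIndContained I.G) :
    IsLRepresentation I.G I.path :=
  (chains_of_laminar (laminar_of_not_hasSBull hG hB) (noTriple_of_not_isIndContained hG hU)
    (noTwoForks_of_not_isIndContained hG hS)).isLRepresentation hG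

end Inst

/-! ### The algorithm -/

open Ctx

/-- The pair `x` shows that the partition is not a split partition. -/
def IsBadPair (I : Inst) (x : Fin 2 → Fin I.n) : Prop :=
  x 0 ≠ x 1 ∧ (x 0 ∈ I.C ∧ x 1 ∈ I.C ∧ ¬ I.G.Adj (x 0) (x 1) ∨
    x 0 ∉ I.C ∧ x 1 ∉ I.C ∧ I.G.Adj (x 0) (x 1))

/-- The tuple `x` is an induced copy of `H`, where the vertices in `Z` lie in the stable set. -/
def IsCopy {k : ℕ} (H : SimpleGraph (Fin k)) (Z : Set (Fin k)) (I : Inst)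
    (x : Fin k → Fin I.n) : Prop :=
  (∀ i j, x i = x j → i = j) ∧ (∀ i j, I.G.Adj (x i) (x j) ↔ H.Adj i j) ∧ ∀ i, i ∈ Z → x i ∉ I.C

/-- The vertices of the bull that have to lie in the stable set. -/
def bullEnds : Set (Fin 5) := {v | (bull.neighborSet v).ncard < 3}

/-- `U₁` on an initial segment of the natural numbers. -/
def U1Fin : SimpleGraph (Fin 7) := U1.comap (finSumFinEquiv (m := 4) (n := 3)).symm

/-- `S₄` on an initial segment of the natural numbers. -/
def S4Fin : SimpleGraph (Fin 10) := S4.comap (finSumFinEquiv (m := 6) (n := 4)).symm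

theorem pcTuple_isBadPair : PCTuple IsBadPair := fun _ _ =>
  ((PCV.coord 0).eq (PCV.coord 1)).not.and <|
    .or ((PCV.coord 0).mem.and <| (PCV.coord 1).mem.and ((PCV.coord 0).adj (PCV.coord 1)).not)
      ((PCV.coord 0).mem.not.and <| (PCV.coord 1).mem.not.and ((PCV.coord 0).adj (PCV.coord 1)))

theorem pcTuple_isCopy {k : ℕ} (H : SimpleGraph (Fin k)) (Z : Set (Fin k)) :
    PCTuple (IsCopy H Z) := fun _ _ =>
  .and (.forall_fin fun i => .forall_fin fun j =>
    ((PCV.coord i).eq (PCV.coord j)).imp (.const (i = j))) <|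
  .and (.forall_fin fun i => .forall_fin fun j =>
    ((PCV.coord i).adj (PCV.coord j)).iff (.const (H.Adj i j)))
  (.forall_fin fun i => (PCP.const (i ∈ Z)).imp (PCV.coord i).mem.not)

/-- The embedding given by an induced copy. -/
def IsCopy.toEmbedding {k : ℕ} {H : SimpleGraph (Fin k)} {Z : Set (Fin k)} {I : Inst}
    {x : Fin k → Fin I.n} (h : IsCopy H Z I x) : H ↪g I.G where
  toFun := x
  inj' := fun i j => h.1 i j
  map_rel_iff' := fun {i j} => h.2.1 i j

theorem IsCopy.of_embedding {k : ℕ} {H : SimpleGraph (Fin k)} {Z : Set (Fin k)} {I : Inst}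
    (f : H ↪g I.G) (hZ : ∀ i, i ∈ Z → f i ∉ I.C) : IsCopy H Z I f :=
  ⟨fun _ _ h => f.injective h, fun _ _ => f.map_adj_iff, hZ⟩

open Classical in
/-- The case distinction of the algorithm: `f i` is chosen if `i` is the verdict. -/
noncomputable def byVerdict (I : Inst) (f : ℕ → ℕ) : ℕ :=
  if ∃ x, IsBadPair I x then f 1 else if ∃ x, IsCopy bull bullEnds I x then f 2
  else if ∃ x, IsCopy U1Fin ∅ I x then f 3 else if ∃ x, IsCopy S4Fin ∅ I x then f 4 else f 0

/-- The certificate in array `2`, according to the verdict. -/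
noncomputable def certificate (I : Inst) (v : Fin I.n) : ℕ → ℕ
  | 0 => I.outX v
  | 1 => witness (IsBadPair I) v
  | 2 => witness (IsCopy bull bullEnds I) v
  | 3 => witness (IsCopy U1Fin ∅ I) v
  | _ => witness (IsCopy S4Fin ∅ I) v

theorem PC.byVerdict {Γ : Type} [Ctx Γ] {f : Γ → ℕ → ℕ} (hf : ∀ i, PC (fun γ => f γ i)) :
    PC (fun γ => byVerdict (inst γ) (f γ)) :=
  .ite (.existsTuple (pcTuple_isBadPair Γ)) (hf 1) <|
  .ite (.existsTuple (pcTuple_isCopy _ _ Γ)) (hf 2) <|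
  .ite (.existsTuple (pcTuple_isCopy _ _ Γ)) (hf 3) <|
  .ite (.existsTuple (pcTuple_isCopy _ _ Γ)) (hf 4) (hf 0)

theorem PCV.certificate {Γ : Type} [Ctx Γ] {v : (γ : Γ) → Fin (inst γ).n} (hv : PCV v) :
    ∀ i, PC (fun γ => certificate (inst γ) (v γ) i)
  | 0 => hv.outX
  | 1 => pcTuple_isBadPair.witness hv
  | 2 => (pcTuple_isCopy _ _).witness hv
  | 3 => (pcTuple_isCopy _ _).witness hv
  | _ + 4 => (pcTuple_isCopy _ _).witness hv

/-- Array 2 is filled only at indices below `n`; by this bound the whole certificate fits. -/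
theorem le_of_isCopy {k : ℕ} {H : SimpleGraph (Fin k)} {Z : Set (Fin k)} {I : Inst}
    {x : Fin k → Fin I.n} (h : IsCopy H Z I x) : k ≤ I.n := by
  simpa using Fintype.card_le_of_injective x h.toEmbedding.injective

/-- The memory that holds the verdict and the certificate is a correct output. -/
theorem correctOutput {I : Inst} {σ : Store} (h₁ : σ.var 1 = byVerdict I id)
    (h₂ : ∀ v : Fin I.n, σ.arr 2 v = byVerdict I (certificate I v))
    (h₃ : ∀ v : Fin I.n, σ.arr 3 v = I.outY v) (h₄ : ∀ v : Fin I.n, σ.arr 4 v = I.outUp v)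
    (h₅ : ∀ v : Fin I.n, σ.arr 5 v = I.outRight v) : CorrectOutput I.G I.C σ := by
  have h₂' (i : ℕ) (hi : i < I.n) : σ.arr 2 i = byVerdict I (certificate I ⟨i, hi⟩) := h₂ ⟨i, hi⟩
  by_cases hbad : ∃ x, IsBadPair I x
  · simp only [byVerdict, if_pos hbad, id, certificate] at h₁ h₂'
    obtain ⟨x, hx, hw⟩ := exists_witness_eq hbad
    have hn : 2 ≤ I.n := by
      have := (x 0).2
      have := (x 1).2
      have := Fin.val_ne_iff.2 hx.1
      omega
    exact .notSplit (x 0) (x 1) h₁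
      ⟨(h₂' 0 (by omega)).trans (hw 0), (h₂' 1 (by omega)).trans (hw 1)⟩ hx
  have hsplit : IsSplitPartition I.G I.C I.Cᶜ := by
    refine ⟨isCompl_compl, fun u hu v hv huv => ?_, fun u hu v hv huv hadj => ?_⟩
    · by_contra hadj
      exact hbad ⟨![u, v], huv, .inl ⟨hu, hv, hadj⟩⟩
    · exact hbad ⟨![u, v], huv, .inr ⟨hu, hv, hadj⟩⟩
  by_cases hbull : ∃ x, IsCopy bull bullEnds I x
  · simp only [byVerdict, if_neg hbad, if_pos hbull, id, certificate] at h₁ h₂'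
    obtain ⟨x, hx, hw⟩ := exists_witness_eq hbull
    have hn := le_of_isCopy hx
    exact .sBull hx.toEmbedding h₁ (fun i => (h₂' i (by omega)).trans (hw i))
      fun i hi => hx.2.2 i hi
  by_cases hU : ∃ x, IsCopy U1Fin ∅ I x
  · simp only [byVerdict, if_neg hbad, if_neg hbull, if_pos hU, id, certificate] at h₁ h₂'
    obtain ⟨x, hx, hw⟩ := exists_witness_eq hU
    have hn := le_of_isCopy hx
    refine .u1 (hx.toEmbedding.comp
        (SimpleGraph.Iso.comap (finSumFinEquiv (m := 4) (n := 3)).symm U1).symm.toEmbedding) h₁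
      (fun i => ?_) fun j => ?_
    · exact (h₂' i (by omega)).trans (hw (Fin.castAdd 3 i))
    · exact (h₂' (4 + j) (by omega)).trans (hw (Fin.natAdd 4 j))
  by_cases hS : ∃ x, IsCopy S4Fin ∅ I x
  · simp only [byVerdict, if_neg hbad, if_neg hbull, if_neg hU, if_pos hS, id, certificate]
      at h₁ h₂'
    obtain ⟨x, hx, hw⟩ := exists_witness_eq hS
    have hn := le_of_isCopy hx
    refine .s4 (hx.toEmbedding.comp
        (SimpleGraph.Iso.comap (finSumFinEquiv (m := 6) (n := 4)).symm S4).symm.toEmbedding) h₁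
      (fun i => ?_) fun j => ?_
    · exact (h₂' i (by omega)).trans (hw (Fin.castAdd 4 i))
    · exact (h₂' (6 + j) (by omega)).trans (hw (Fin.natAdd 6 j))
  simp only [byVerdict, if_neg hbad, if_neg hbull, if_neg hU, if_neg hS, id, certificate] at h₁ h₂
  have hbull' : ¬ HasSBull I.G I.Cᶜ := fun ⟨f, hf⟩ => hbull ⟨f, .of_embedding f hf⟩
  refine .representation I.path h₁ hsplit hbull' (fun v => ?_)
    (fun v => ⟨I.outUp_pos v, I.outRight_pos v⟩)
    (Inst.isLRepresentation_path hsplit hbull' ?_ ?_)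
  · rw [h₂, h₃, h₄, h₅]
    exact ⟨rfl, rfl, rfl⟩
  · exact fun ⟨f⟩ => hU ⟨_, .of_embedding (f.comp
      (SimpleGraph.Iso.comap (finSumFinEquiv (m := 4) (n := 3)).symm U1).toEmbedding) (by simp)⟩
  · exact fun ⟨f⟩ => hS ⟨_, .of_embedding (f.comp
      (SimpleGraph.Iso.comap (finSumFinEquiv (m := 6) (n := 4)).symm S4).toEmbedding) (by simp)⟩

theorem exists_certifying_program : ∃ (p : Prog) (q : Polynomial ℕ),
    ∀ (n : ℕ) (G : SimpleGraph (Fin n)) (C : Set (Fin n)), ∃ (t : ℕ) (σ : Store),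
      Run p (inputStore G C) t σ ∧ t ≤ q.eval n ∧ CorrectOutput G C σ := by
  -- The verdict is computed in variable 2 and moved to variable 1, which the array-writing programs
  -- preserve. Arrays 3 to 5 are written whatever the verdict is.
  obtain ⟨p₁, q₁, hp₁⟩ := PC.byVerdict (Γ := Inst) (f := fun _ => id) (fun i => .const i)
    (fun _ => 0) 2 (by omega) (fun _ _ => by omega)
  obtain ⟨p₂, q₂, hp₂⟩ := PC.exists_writeArr (a := 2)
    (f := fun I v => byVerdict I (certificate I v)) (.byVerdict (PCV.certificate .snd)) (by omega)
  obtain ⟨p₃, q₃, hp₃⟩ := PC.exists_writeArr (a := 3) (f := Inst.outY) (PCV.outY .snd) (by omega)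
  obtain ⟨p₄, q₄, hp₄⟩ := PC.exists_writeArr (a := 4) (f := Inst.outUp) (PCV.outUp .snd) (by omega)
  obtain ⟨p₅, q₅, hp₅⟩ := PC.exists_writeArr (a := 5) (f := Inst.outRight) (PCV.outRight .snd)
    (by omega)
  refine ⟨.seq p₁ (.seq (.assign 1 (.var 2)) (.seq p₂ (.seq p₃ (.seq p₄ p₅)))),
    q₁ + (2 + (q₂ + (q₃ + (q₄ + q₅)))), fun n G C => ?_⟩
  let I : Inst := ⟨n, G, C⟩
  obtain ⟨τ, hτ, hv, hS⟩ := hp₁ I (inputStore G C)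
    ⟨rfl, rfl, rfl, fun i hi => absurd hi (Nat.not_lt_zero i)⟩
  obtain ⟨τ₂, hτ₂, hv₂, ha₂, h1₂, hH₂⟩ := hp₂ I (τ.setVar 1 (τ.var 2))
    ⟨by rw [Store.setVar_var_ne _ _ (by omega), hS.var 0 (by omega)]; rfl,
      by rw [Store.setVar_arr, hS.arr]; rfl, by rw [Store.setVar_arr, hS.arr]; rfl,
      fun i hi => absurd hi (Nat.not_lt_zero i)⟩
  obtain ⟨τ₃, hτ₃, hv₃, ha₃, h1₃, hH₃⟩ := hp₃ I τ₂ hH₂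
  obtain ⟨τ₄, hτ₄, hv₄, ha₄, h1₄, hH₄⟩ := hp₄ I τ₃ hH₃
  obtain ⟨τ₅, hτ₅, hv₅, ha₅, h1₅, -⟩ := hp₅ I τ₄ hH₄
  obtain ⟨t, ht, hr⟩ := hτ.seq ((Exec.assign 1 (.var 2) τ).seq
    (hτ₂.seq (hτ₃.seq (hτ₄.seq hτ₅))))
  refine ⟨t, τ₅, hr, ht.trans (le_of_eq ?_), correctOutput (I := I) ?_ ?_ ?_ ?_ hv₅⟩
  · simp [Expr.cost, I, Ctx.inst]
  · rw [h1₅, h1₄, h1₃, h1₂, Store.setVar_var_self, hv]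
    rfl
  · rwa [ha₅ 2 (by omega), ha₄ 2 (by omega), ha₃ 2 (by omega)]
  · rwa [ha₅ 3 (by omega), ha₄ 3 (by omega)]
  · rwa [ha₅ 4 (by omega)]

/-! ### Graphs on arbitrary finite vertex sets -/

theorem exists_hasBend_isLRepresentation {V : Type*} [Finite V] {G : SimpleGraph V} {C S : Set V}
    (hG : IsSplitPartition G C S) (hB : ¬ HasSBull G S) (hU : ¬ U1.IsIndContained G)
    (hS : ¬ S4.IsIndContained G) :
    ∃ P : V → LPath, (∀ v, (P v).HasBend) ∧ IsLRepresentation G P := by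
  obtain rfl : S = Cᶜ := hG.1.compl_eq.symm
  let e := Finite.equivFin V
  let I : Inst := ⟨Nat.card V, G.comap e.symm, e.symm ⁻¹' C⟩
  let φ : I.G ≃g G := SimpleGraph.Iso.comap e.symm G
  have hrep : IsLRepresentation I.G I.path := by
    refine Inst.isLRepresentation_path ⟨isCompl_compl, ?_, ?_⟩ ?_ ?_ ?_
    · exact fun u hu v hv huv => hG.2.1 hu hv (e.symm.injective.ne huv)
    · exact fun u hu v hv huv => hG.2.2 hu hv (e.symm.injective.ne huv)
    · exact fun ⟨f, hf⟩ => hB ⟨φ.toEmbedding.comp f, fun v hv => hf v hv⟩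
    · exact fun ⟨f⟩ => hU ⟨φ.toEmbedding.comp f⟩
    · exact fun ⟨f⟩ => hS ⟨φ.toEmbedding.comp f⟩
  exact ⟨_, fun v => ⟨I.outUp_pos _, I.outRight_pos _⟩, hrep.comp φ.symm.toEmbedding⟩

end EPG

theorem mainTheorem2 :
    (∀ (V : Type*) [Finite V] (G : SimpleGraph V) (C S : Set V),
      EPG.IsSplitPartition G C S → ¬ EPG.HasSBull G S →
        ((∃ P : V → EPG.LPath, EPG.IsLRepresentation G P) ↔
          ¬ EPG.U1.IsIndContained G ∧ ¬ EPG.S4.IsIndContained G) ∧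
        ((∃ P : V → EPG.LPath, (∀ v, (P v).HasBend) ∧ EPG.IsLRepresentation G P) ↔
          ¬ EPG.U1.IsIndContained G ∧ ¬ EPG.S4.IsIndContained G)) ∧
    (∃ (p : EPG.Prog) (q : Polynomial ℕ),
      ∀ (n : ℕ) (G : SimpleGraph (Fin n)) (C : Set (Fin n)),
        ∃ (t : ℕ) (σ : EPG.Store),
          EPG.Run p (EPG.inputStore G C) t σ ∧ t ≤ q.eval n ∧ EPG.CorrectOutput G C σ) := by
  refine ⟨fun V _ G C S hG hB => ?_, EPG.exists_certifying_program⟩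
  have h := EPG.exists_hasBend_isLRepresentation hG hB
  exact ⟨⟨fun ⟨_, hP⟩ => hP.not_isIndContained, fun ⟨hU, hS⟩ => (h hU hS).imp fun _ hP => hP.2⟩,
    ⟨fun ⟨_, _, hP⟩ => hP.not_isIndContained, fun ⟨hU, hS⟩ => h hU hS⟩⟩
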